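/- Let $\mathbb{S}^1=\mathbb{R}/\mathbb{Z}$. For an orientation preserving homeomorphism $f:\mathbb{S}^1\to\mathbb{S}^1$, the rotation number is $\rho(f)=\lim_{n\to\infty}\widetilde f^{\,n}(x)/n \bmod \mathbb{Z}$, where $\widetilde f:\mathbb{R}\to\mathbb{R}$ is any lift of $f$ and $x\in\mathbb{R}$ is any point (the limit exists and, modulo $\mathbb{Z}$, does not depend on these choices). Thompson's group $\mathbf{T}$ is the group of homeomorphisms $f$ of $\mathbb{S}^1$ that preserve the set of dyadic rational points (those represented by numbers $p\cdot 2^q$ with $p,q\in\mathbb{Z}$) and are affine except at finitely many dyadic rational points, with slope an integral power of $2$ on each interval on which $f$ is affine; such an $f$ is orientation preserving. Equivalently, $\mathbf{T}$ is realized as the group of piecewise linear automorphisms of $\mathbb{Z}^2$: the orientation preserving homeomorphisms $F:\mathbb{R}^2\to\mathbb{R}^2$ with $F(\mathbb{Z}^2)=\mathbb{Z}^2$ for which $\mathbb{R}^2$ can be divided into finitely many convex sectors, each spanned by two linearly independent integral vectors and with pairwise disjoint interiors, such that $F$ agrees with a linear map on each sector. Such an $F$ permutes the rays $\{s(\cos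 2\pi t,\sin 2\pi t): s\ge 0\}$, $t\in\mathbb{R}/\mathbb{Z}$, and so induces an orientation preserving homeomorphism of $\mathbb{R}/\mathbb{Z}$; its rotation number is denoted $\rho(F)$. **Theorem A.** I. For every $f\in\mathbf{T}$ the rotation number $\rho(f)$ is rational, i.e. the class modulo $\mathbb{Z}$ of a rational number. II. For every rational number $r$ there is an element $f\in\mathbf{T}$ such that $\rho(f)=r \bmod \mathbb{Z}$. Both I and II hold in either realization: for $\mathbf{T}$ as the group of dyadic circle homeomorphisms, and for $\mathbf{T}$ as the group of piecewise linear automorphisms of $\mathbb{Z}^2$ acting on the circle of rays. -/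

import Mathlib

open Filter Topology
open scoped Matrix

/-! ### Circle homeomorphisms and rotation numbers

The circle is `UnitAddCircle = ℝ / ℤ`, i.e. `[0,1]` with endpoints identified. -/

/-- `g : ℝ → ℝ` is a lift of the circle homeomorphism `f` to the universal cover `ℝ → ℝ / ℤ`. -/
def IsCircleLift (f : UnitAddCircle ≃ₜ UnitAddCircle) (g : ℝ → ℝ) : Prop :=
  Continuous g ∧ ∀ x : ℝ, ((g x : ℝ) : UnitAddCircle) = f (x : UnitAddCircle)

/-- A circle homeomorphism is orientation preserving if it has an increasing lift. -/
def IsOrientationPreserving (f : UnitAddCircle ≃ₜ UnitAddCircle) : Prop :=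
  ∃ g : ℝ → ℝ, IsCircleLift f g ∧ StrictMono g

/-- `f` is an orientation preserving circle homeomorphism, and its rotation number is
`ρ ∈ ℝ / ℤ`: for every lift `g` of `f` and every initial point `x`, the limit of `gⁿ(x) / n`
exists and reduces to `ρ` modulo `ℤ`. -/
def HasRotationNumber (f : UnitAddCircle ≃ₜ UnitAddCircle) (ρ : UnitAddCircle) : Prop :=
  IsOrientationPreserving f ∧
    ∀ g : ℝ → ℝ, IsCircleLift f g → ∀ x : ℝ,
      ∃ l : ℝ, Tendsto (fun n : ℕ => g^[n] x / (n : ℝ)) atTop (𝓝 l) ∧ (l : UnitAddCircle) = ρ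

/-! ### Thompson's group `T` as the group of dyadic circle homeomorphisms -/

/-- The dyadic rational points `p * 2 ^ q` (`p`, `q` integers) of the circle `ℝ / ℤ`. -/
def dyadicPoints : Set UnitAddCircle :=
  {θ | ∃ p q : ℤ, θ = (((p : ℝ) * (2 : ℝ) ^ q : ℝ) : UnitAddCircle)}

/-- The elements of Thompson's group `T`: the circle homeomorphisms `f` that preserve the set of
dyadic rational points, and for which there is a finite set `B` of dyadic rational points such
that on each interval avoiding `B`, `f` is given by an affine map whose slope is a power
of `2`. -/
def thompsonT : Set (UnitAddCircle ≃ₜ UnitAddCircle) :=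
  {f | f '' dyadicPoints = dyadicPoints ∧
    ∃ B : Set UnitAddCircle, B.Finite ∧ B ⊆ dyadicPoints ∧
      ∀ a b : ℝ, (∀ x ∈ Set.Ioo a b, (x : UnitAddCircle) ∉ B) →
        ∃ (k : ℤ) (c : ℝ), ∀ x ∈ Set.Ioo a b,
          f (x : UnitAddCircle) = (((2 : ℝ) ^ k * x + c : ℝ) : UnitAddCircle)}

/-! ### Fans and piecewise linear automorphisms of `ℤ²` -/

/-- The lattice point of `ℝ²` with the given integer coordinates. -/
def latticePoint (v : Fin 2 → ℤ) : Fin 2 → ℝ := fun i => (v i : ℝ)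

/-- The lattice `ℤ²` inside `ℝ²`. -/
def integerLattice : Set (Fin 2 → ℝ) := Set.range latticePoint

/-- The closed convex cone `ℝ₊ v + ℝ₊ w`. -/
def closedCone (v w : Fin 2 → ℝ) : Set (Fin 2 → ℝ) :=
  {x | ∃ a b : ℝ, 0 ≤ a ∧ 0 ≤ b ∧ x = a • v + b • w}

/-- The relatively open cone of `v`, `w`; the interior of `closedCone v w` when `v`, `w` are
linearly independent. -/
def openCone (v w : Fin 2 → ℝ) : Set (Fin 2 → ℝ) :=
  {x | ∃ a b : ℝ, 0 < a ∧ 0 < b ∧ x = a • v + b • w}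

/-- A complete fan in `ℝ²` with `d + 1` rays in counterclockwise order, given by their primitive
integral generators. The indices are cyclic (in `Fin (d + 1)` one has `d + 1 = 0`), and the
sectors are the cones spanned by two consecutive generators. -/
structure CompleteFan where
  d : ℕ
  gen : Fin (d + 1) → Fin 2 → ℤ
  primitive : ∀ i, IsCoprime (gen i 0) (gen i 1)
  counterclockwise : ∀ i, 0 < gen i 0 * gen (i + 1) 1 - gen i 1 * gen (i + 1) 0
  disjoint : ∀ i j, i ≠ j →
    Disjoint (openCone (latticePoint (gen i)) (latticePoint (gen (i + 1))))
      (openCone (latticePoint (gen j)) (latticePoint (gen (j + 1))))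
  complete : ⋃ i, closedCone (latticePoint (gen i)) (latticePoint (gen (i + 1))) = Set.univ

/-- The `i`-th sector of a fan. -/
def CompleteFan.sector (Δ : CompleteFan) (i : Fin (Δ.d + 1)) : Set (Fin 2 → ℝ) :=
  closedCone (latticePoint (Δ.gen i)) (latticePoint (Δ.gen (i + 1)))

/-- The piecewise linear automorphisms of `ℤ²`: the homeomorphisms `F` of `ℝ²` that are given
on each sector of some fan by a linear map, that preserve orientation (i.e. each of these linear
maps does), and that satisfy `F(ℤ²) = ℤ²`. -/
def plAutomorphisms : Set ((Fin 2 → ℝ) ≃ₜ (Fin 2 → ℝ)) :=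
  {F | (∃ (Δ : CompleteFan) (L : Fin (Δ.d + 1) → Matrix (Fin 2) (Fin 2) ℝ),
      ∀ i, 0 < (L i).det ∧ ∀ x ∈ Δ.sector i, F x = L i *ᵥ x) ∧
    F '' integerLattice = integerLattice}

/-! ### The action on the circle of real rays -/

/-- The real ray in direction `(cos 2πt, sin 2πt)`. -/
noncomputable def realRay (t : ℝ) : Set (Fin 2 → ℝ) :=
  {x | ∃ s : ℝ, 0 ≤ s ∧ x = s • ![Real.cos (2 * Real.pi * t), Real.sin (2 * Real.pi * t)]}

/-- The circle homeomorphism `f` is the action of `F` on the set of real rays, which is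
parameterized counterclockwise by `ℝ / ℤ` through `t ↦ realRay t`. -/
def InducesOnRays (F : (Fin 2 → ℝ) ≃ₜ (Fin 2 → ℝ)) (f : UnitAddCircle ≃ₜ UnitAddCircle) : Prop :=
  ∀ s t : ℝ, f (s : UnitAddCircle) = (t : UnitAddCircle) → F '' realRay s = realRay t

/-- `F` acts on the circle of real rays by an (orientation preserving) homeomorphism with rotation
number `ρ`. -/
def HasRayRotationNumber (F : (Fin 2 → ℝ) ≃ₜ (Fin 2 → ℝ)) (ρ : UnitAddCircle) : Prop :=
  ∃ f : UnitAddCircle ≃ₜ UnitAddCircle, InducesOnRays F f ∧ HasRotationNumber f ρ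

/-!
# Rotation numbers in Thompson's group `T`

**Rationality.** Both realizations of `T` are treated by one criterion,
`CircleDeg1Lift.not_irrational_translationNumber`. Let `g` be a lift with irrational translation
number `τ`, and let `ψ` be a function of bounded variation on the circle, in the role of the
logarithm of the derivative of `g`. At a time `n` of closest return of the rotation by `τ`, the arc
between `x` and `g⁻ⁿ(x)` has `n` disjoint images (`CircleDeg1Lift.disjoint_arcs`), so Denjoy's
inequality bounds the difference of the sums of `ψ` along the forward and the backward orbit of
length `n`. On the other hand, the orbit of a suitable arithmetic point `x` carries a height which
changes by `ψ` at each step. An infinite orbit leaves every finite set in both directions, so the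
height tends to infinity at both ends, and this contradicts Denjoy's bound.

For dyadic homeomorphisms, `x = 1/3`, the height is the exponent of `2` in the denominator, and `-ψ`
is the logarithm in base `2` of the slope, a step function. The point `1/3` is used because its
orbit avoids the dyadic break points. For piecewise linear automorphisms of `ℤ²`, `x` is the ray of
a lattice vector, the height is the logarithm of the length of the image vectors, and `ψ` is the
logarithm of the factor by which unit vectors are stretched. There are only finitely many points
or vectors of bounded height.

**Realization.** It suffices to find elements with rotation number `k / N` in lowest terms, for
arbitrarily divisible `N`, and to take powers (`exists_pow_hasRotationNumber`). In the dyadic case a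
map with three affine pieces permutes the points `1 - 2⁻ⁱ` cyclically. In the piecewise linear
case, the rotation by one sector of a complete unimodular fan with `N` rays has order `N` and none
of its smaller powers fixes a ray.
-/

/-! ### Lifts of circle homeomorphisms -/

theorem UnitAddCircle.coe_eq_coe_iff {x y : ℝ} :
    (x : UnitAddCircle) = (y : UnitAddCircle) ↔ ∃ n : ℤ, y = x + n := by
  rw [eq_comm, ← sub_eq_zero, ← AddCircle.coe_sub, AddCircle.coe_eq_zero_iff]
  simp only [zsmul_eq_mul, mul_one]
  exact exists_congr fun n => ⟨fun h => by linarith, fun h => by linarith⟩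

theorem UnitAddCircle.coe_add_int (x : ℝ) (n : ℤ) :
    ((x + n : ℝ) : UnitAddCircle) = (x : UnitAddCircle) :=
  (UnitAddCircle.coe_eq_coe_iff.2 ⟨n, rfl⟩).symm

theorem UnitAddCircle.coe_surjective : Function.Surjective ((↑) : ℝ → UnitAddCircle) :=
  QuotientAddGroup.mk_surjective

/-- A continuous integer-valued function on a connected set of reals is constant. -/
theorem exists_int_forall_eq_of_isPreconnected {h : ℝ → ℝ} {s : Set ℝ} (hs : IsPreconnected s)
    (hc : ContinuousOn h s) (hi : ∀ x ∈ s, ∃ n : ℤ, h x = n) : ∃ n : ℤ, ∀ x ∈ s, h x = n := by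
  rcases s.eq_empty_or_nonempty with rfl | ⟨x₀, hx₀⟩
  · exact ⟨0, by simp⟩
  obtain ⟨n, hn⟩ := hi x₀ hx₀
  have key : ∀ x ∈ s, ∀ y ∈ s, ¬ h x < h y := by
    intro x hx y hy hlt
    obtain ⟨a, ha⟩ := hi x hx
    obtain ⟨b, hb⟩ := hi y hy
    have hab : a < b := by
      rw [ha, hb] at hlt
      exact_mod_cast hlt
    have hab' : (a : ℝ) + 1 ≤ b := by exact_mod_cast hab
    have hm : (a : ℝ) + 1 / 2 ∈ Set.Icc (h x) (h y) := by
      rw [ha, hb]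
      constructor <;> linarith
    obtain ⟨z, hz, hz'⟩ := hs.intermediate_value hx hy hc hm
    obtain ⟨c, hc⟩ := hi z hz
    rw [hc] at hz'
    have h1 : (2 * c : ℝ) = 2 * a + 1 := by linarith
    have h2 : 2 * c = 2 * a + 1 := by exact_mod_cast h1
    omega
  refine ⟨n, fun x hx => ?_⟩
  rw [← hn]
  exact le_antisymm (not_lt.1 (key _ hx₀ _ hx)) (not_lt.1 (key _ hx _ hx₀))

theorem exists_isCircleLift (f : UnitAddCircle ≃ₜ UnitAddCircle) :
    ∃ g : ℝ → ℝ, IsCircleLift f g := by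
  have cov : IsCoveringMap ((↑) : ℝ → AddCircle (1 : ℝ)) := AddCircle.isCoveringMap_coe 1
  obtain ⟨e, he⟩ := UnitAddCircle.coe_surjective (f ((0 : ℝ) : UnitAddCircle))
  obtain ⟨F, ⟨-, hF⟩, -⟩ := cov.existsUnique_continuousMap_lifts
    (⟨fun x : ℝ => f (x : UnitAddCircle), f.continuous.comp (AddCircle.continuous_mk' 1)⟩ :
      C(ℝ, AddCircle (1 : ℝ))) 0 e he
  exact ⟨F, F.continuous, fun x => congrFun hF x⟩

namespace IsCircleLift

variable {f : UnitAddCircle ≃ₜ UnitAddCircle} {g : ℝ → ℝ}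

theorem exists_sub_eq_int {g' : ℝ → ℝ} (hg : IsCircleLift f g) (hg' : IsCircleLift f g') :
    ∃ n : ℤ, ∀ x, g' x = g x + n := by
  obtain ⟨n, hn⟩ := exists_int_forall_eq_of_isPreconnected (h := fun x => g' x - g x)
    isPreconnected_univ (hg'.1.sub hg.1).continuousOn (fun x _ => by
      obtain ⟨n, hn⟩ := UnitAddCircle.coe_eq_coe_iff.1 ((hg.2 x).trans (hg'.2 x).symm)
      exact ⟨n, by rw [hn]; ring⟩)
  exact ⟨n, fun x => by linarith [hn x trivial]⟩

theorem exists_degree (hg : IsCircleLift f g) : ∃ d : ℤ, ∀ x, g (x + 1) = g x + d :=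
  hg.exists_sub_eq_int (g' := fun x => g (x + 1)) ⟨hg.1.comp (by fun_prop), fun x => by
    rw [hg.2]
    congr 1
    simp⟩

theorem exists_int_of_coe_eq (hg : IsCircleLift f g) {x y : ℝ} {m : ℤ} (h : g y = g x + m) :
    ∃ n : ℤ, y = x + n := by
  have : (g y : UnitAddCircle) = (g x : UnitAddCircle) := by
    rw [h, UnitAddCircle.coe_add_int]
  rw [hg.2, hg.2] at this
  exact UnitAddCircle.coe_eq_coe_iff.1 (f.injective this).symm

theorem injOn_Ico (hg : IsCircleLift f g) (a : ℝ) : Set.InjOn g (Set.Ico a (a + 1)) := by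
  intro x hx y hy hxy
  obtain ⟨n, hn⟩ := hg.exists_int_of_coe_eq (x := x) (y := y) (m := 0) (by simp [hxy])
  have h1 : (n : ℝ) < 1 := by linarith [hx.1, hy.2]
  have h2 : (-1 : ℝ) < n := by linarith [hx.2, hy.1]
  have h3 : n = 0 := by
    have : n < 1 := by exact_mod_cast h1
    have : -1 < n := by exact_mod_cast h2
    omega
  simp [hn, h3]

/-- A lift is strictly monotone because it is injective. Its degree `d` is the point: `d = 0` would
make the lift periodic, while it is injective on every half-open period. -/
theorem strictMono_or_strictAnti (hg : IsCircleLift f g) : StrictMono g ∨ StrictAnti g := by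
  refine hg.1.strictMono_of_inj fun x y hxy => ?_
  obtain ⟨d, hd⟩ := hg.exists_degree
  have hd0 : d ≠ 0 := by
    rintro rfl
    -- `g` is monotone on the overlapping intervals `[0, 3/4]` and `[1/4, 1]`, against `g 1 = g 0`
    have h1 : g 1 = g 0 := by simpa using hd 0
    have hinj : Set.InjOn g (Set.Icc 0 (3 / 4)) :=
      (hg.injOn_Ico 0).mono (by
        rw [zero_add]
        exact Set.Icc_subset_Ico_right (by norm_num))
    have hinj' : Set.InjOn g (Set.Icc (1 / 4) 1) :=
      (hg.injOn_Ico (1 / 4)).mono (Set.Icc_subset_Ico_right (by norm_num))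
    have m1 := hg.1.continuousOn.strictMonoOn_of_injOn_Icc' (by norm_num) hinj
    have m2 := hg.1.continuousOn.strictMonoOn_of_injOn_Icc' (by norm_num) hinj'
    have i0 : (0 : ℝ) ∈ Set.Icc (0 : ℝ) (3 / 4) := by norm_num
    have i1 : (1 / 2 : ℝ) ∈ Set.Icc (0 : ℝ) (3 / 4) := by norm_num
    have i2 : (3 / 4 : ℝ) ∈ Set.Icc (0 : ℝ) (3 / 4) := by norm_num
    have j0 : (1 / 2 : ℝ) ∈ Set.Icc (1 / 4 : ℝ) 1 := by norm_num
    have j1 : (3 / 4 : ℝ) ∈ Set.Icc (1 / 4 : ℝ) 1 := by norm_num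
    have j2 : (1 : ℝ) ∈ Set.Icc (1 / 4 : ℝ) 1 := by norm_num
    have l0 : (0 : ℝ) < 1 / 2 := by norm_num
    have l1 : (1 / 2 : ℝ) < 3 / 4 := by norm_num
    have l2 : (3 / 4 : ℝ) < 1 := by norm_num
    rcases m1 with m1 | m1 <;> rcases m2 with m2 | m2 <;>
      linarith [m1 i0 i1 l0, m1 i1 i2 l1, m2 j0 j1 l1, m2 j1 j2 l2]
  obtain ⟨n, hn⟩ := hg.exists_int_of_coe_eq (x := x) (y := y) (m := 0) (by simp [hxy])
  have hk : ∀ k : ℕ, ∀ z, g (z + k) = g z + k * d := by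
    intro k
    induction k with
    | zero => simp
    | succ k ih => intro z; push_cast; rw [← add_assoc, hd, ih]; ring
  have hn0 : (n : ℝ) * d = 0 := by
    rcases Int.eq_nat_or_neg n with ⟨k, rfl | rfl⟩
    · have := hk k x
      push_cast at hn ⊢
      rw [← hn] at this
      linarith
    · have := hk k y
      push_cast at hn ⊢
      rw [hn] at this
      rw [hn] at hxy
      simp only [neg_add_cancel_right] at this
      linarith
  have : n = 0 := by
    rcases mul_eq_zero.1 hn0 with h | h
    · exact_mod_cast h
    · exact absurd (by exact_mod_cast h) hd0
  simp [hn, this]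

theorem map_add_one (hg : IsCircleLift f g) (hm : StrictMono g) (x : ℝ) : g (x + 1) = g x + 1 := by
  obtain ⟨d, hd⟩ := hg.exists_degree
  have hd1 : 0 < d := by
    have := hm (show x < x + 1 by linarith)
    rw [hd] at this
    have : (0 : ℝ) < d := by linarith
    exact_mod_cast this
  suffices ¬ 1 < d by
    have : d = 1 := by omega
    rw [hd, this, Int.cast_one]
  intro h
  have h' : (1 : ℝ) < d := by exact_mod_cast h
  obtain ⟨y, hy, hy'⟩ := intermediate_value_Ioo (show x ≤ x + 1 by linarith) hg.1.continuousOn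
    (show g x + 1 ∈ Set.Ioo (g x) (g (x + 1)) by rw [hd]; constructor <;> linarith)
  obtain ⟨n, hn⟩ := hg.exists_int_of_coe_eq (x := x) (y := y) (m := 1) (by simp [hy'])
  have h1 : (n : ℝ) < 1 := by linarith [hy.2]
  have h2 : (0 : ℝ) < n := by linarith [hy.1]
  have : n < 1 := by exact_mod_cast h1
  have : 0 < n := by exact_mod_cast h2
  omega

/-- An increasing lift, bundled as an invertible element of Mathlib's monoid of degree one
lifts. -/
theorem exists_unit (hg : IsCircleLift f g) (hm : StrictMono g) :
    ∃ G : CircleDeg1Liftˣ, ∀ x, G x = g x := by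
  let G : CircleDeg1Lift := ⟨⟨g, hm.monotone⟩, hg.map_add_one hm⟩
  have hG : ⇑G = g := rfl
  have : IsUnit G := CircleDeg1Lift.isUnit_iff_bijective.2
    ⟨hG ▸ hm.injective, G.continuous_iff_surjective.1 (hG ▸ hg.1)⟩
  obtain ⟨u, hu⟩ := this
  exact ⟨u, fun x => by rw [hu, hG]⟩

end IsCircleLift

theorem CircleDeg1Lift.units_continuous (G : CircleDeg1Liftˣ) : Continuous G :=
  (G : CircleDeg1Lift).continuous_iff_surjective.2
    (CircleDeg1Lift.isUnit_iff_bijective.1 G.isUnit).2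

theorem CircleDeg1Lift.units_strictMono (G : CircleDeg1Liftˣ) : StrictMono G :=
  (G : CircleDeg1Lift).strictMono_iff_injective.2
    (CircleDeg1Lift.isUnit_iff_bijective.1 G.isUnit).1

/-- One invertible lift determines the rotation number, since every other continuous lift differs
from it by an integer. -/
theorem hasRotationNumber_translationNumber {f : UnitAddCircle ≃ₜ UnitAddCircle}
    {G : CircleDeg1Liftˣ} (hG : IsCircleLift f G) :
    HasRotationNumber f
      ((CircleDeg1Lift.translationNumber (G : CircleDeg1Lift) : ℝ) : UnitAddCircle) := by
  refine ⟨⟨G, hG, CircleDeg1Lift.units_strictMono G⟩, fun g hg x => ?_⟩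
  obtain ⟨n, hn⟩ := hG.exists_sub_eq_int hg
  have hit : ∀ k : ℕ, g^[k] x = ((G : CircleDeg1Lift) ^ k) x + k * n := by
    intro k
    induction k with
    | zero => simp
    | succ k ih =>
      rw [Function.iterate_succ_apply', ih, hn, pow_succ', CircleDeg1Lift.mul_apply]
      have := (G : CircleDeg1Lift).map_add_int (((G : CircleDeg1Lift) ^ k) x) (k * n)
      push_cast at this ⊢
      rw [this]
      ring
  refine ⟨CircleDeg1Lift.translationNumber (G : CircleDeg1Lift) + n, ?_,
    UnitAddCircle.coe_add_int _ _⟩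
  have h1 := ((G : CircleDeg1Lift).tendsto_translationNumber x).add_const (n : ℝ)
  have h2 : Tendsto (fun k : ℕ => x / (k : ℝ)) atTop (𝓝 0) :=
    tendsto_const_div_atTop_nhds_zero_nat x
  have h3 := h1.add h2
  rw [add_zero] at h3
  refine h3.congr' ?_
  filter_upwards [eventually_gt_atTop 0] with k hk
  have hk' : (k : ℝ) ≠ 0 := by positivity
  rw [hit]
  field_simp
  ring

theorem IsCircleLift.pow {f : UnitAddCircle ≃ₜ UnitAddCircle} {G : CircleDeg1Liftˣ}
    (hG : IsCircleLift f G) (n : ℕ) : IsCircleLift (f ^ n) (G ^ n : CircleDeg1Liftˣ) := by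
  refine ⟨CircleDeg1Lift.units_continuous _, ?_⟩
  induction n with
  | zero => intro x; rfl
  | succ n ih =>
    intro x
    rw [pow_succ', pow_succ', Units.val_mul, CircleDeg1Lift.mul_apply, hG.2, ih]
    rfl

/-- A degree one lift of `ℝ` descends to a homeomorphism of the circle. -/
theorem exists_homeomorph_isCircleLift (G : CircleDeg1Liftˣ) :
    ∃ f : UnitAddCircle ≃ₜ UnitAddCircle, IsCircleLift f G := by
  have hwd : ∀ H : CircleDeg1Liftˣ, ∃ φ : UnitAddCircle → UnitAddCircle, Continuous φ ∧
      ∀ x : ℝ, φ (x : UnitAddCircle) = ((H x : ℝ) : UnitAddCircle) := by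
    intro H
    have h : ∀ a b : ℝ, (QuotientAddGroup.leftRel (AddSubgroup.zmultiples (1 : ℝ))) a b →
        ((H a : ℝ) : UnitAddCircle) = ((H b : ℝ) : UnitAddCircle) := by
      intro a b hab
      have hab' : (a : UnitAddCircle) = (b : UnitAddCircle) := Quotient.sound hab
      obtain ⟨n, rfl⟩ := UnitAddCircle.coe_eq_coe_iff.1 hab'
      rw [(H : CircleDeg1Lift).map_add_int, UnitAddCircle.coe_add_int]
    refine ⟨Quotient.lift (fun x : ℝ => ((H x : ℝ) : UnitAddCircle)) h, ?_, fun x => rfl⟩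
    exact Continuous.quotient_lift ((AddCircle.continuous_mk' 1).comp
      (CircleDeg1Lift.units_continuous H)) h
  obtain ⟨φ, hφ, hφ'⟩ := hwd G
  obtain ⟨χ, hχ, hχ'⟩ := hwd G⁻¹
  refine ⟨⟨⟨φ, χ, ?_, ?_⟩, hφ, hχ⟩, CircleDeg1Lift.units_continuous G, fun x => (hφ' x).symm⟩
  · intro θ
    obtain ⟨x, rfl⟩ := UnitAddCircle.coe_surjective θ
    rw [hφ', hχ', CircleDeg1Lift.units_inv_apply_apply]
  · intro θ
    obtain ⟨x, rfl⟩ := UnitAddCircle.coe_surjective θ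
    rw [hχ', hφ', CircleDeg1Lift.units_apply_inv_apply]

/-! ### Denjoy's argument: a criterion for rational translation numbers -/

/-- An irrational number has infinitely many times of closest return: `n τ` is closer to the
integers than every `j τ` with `0 < j < n`. -/
theorem Irrational.exists_closest_return {t : ℝ} (ht : Irrational t) (N : ℕ) :
    ∃ n : ℕ, N ≤ n ∧ 0 < n ∧ ∃ m : ℤ, |n * t - m| < 1 ∧
      ∀ j : ℕ, 0 < j → j < n → ∀ l : ℤ, |n * t - m| < |j * t - l| := by
  have hpos : ∀ j : ℕ, 0 < j → 0 < |j * t - round (j * t)| := by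
    intro j hj
    refine abs_pos.2 (sub_ne_zero.2 ?_)
    exact (ht.natCast_mul hj.ne').ne_int _
  -- a lower bound `ε` for the distances of the first `N` multiples
  obtain ⟨ε, hε, hε'⟩ : ∃ ε : ℝ, 0 < ε ∧ ∀ j : ℕ, 0 < j → j ≤ N →
      ε ≤ |j * t - round (j * t)| := by
    induction N with
    | zero => exact ⟨1, one_pos, fun j h1 h2 => by omega⟩
    | succ N ih =>
      obtain ⟨ε, hε, h⟩ := ih
      refine ⟨min ε |((N + 1 : ℕ) : ℝ) * t - round (((N + 1 : ℕ) : ℝ) * t)|,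
        lt_min hε (hpos _ N.succ_pos), fun j h1 h2 => ?_⟩
      rcases h2.lt_or_eq with h2 | rfl
      · exact (min_le_left _ _).trans (h j h1 (by omega))
      · exact min_le_right _ _
  have hex : ∃ n : ℕ, 0 < n ∧ |n * t - round (n * t)| < min ε 1 := by
    obtain ⟨K, hK⟩ := exists_nat_one_div_lt (lt_min hε one_pos)
    obtain ⟨k, hk, -, hk'⟩ := Real.exists_nat_abs_mul_sub_round_le t (n := K + 1) K.succ_pos
    refine ⟨k, hk, hk'.trans_lt (lt_of_le_of_lt ?_ hK)⟩
    push_cast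
    apply one_div_le_one_div_of_le <;> [positivity; linarith]
  classical
  have hn := Nat.find_spec hex
  have hmin : ∀ j < Nat.find hex, ¬ _ := fun j hj => Nat.find_min hex hj
  set n := Nat.find hex
  refine ⟨n, ?_, hn.1, round (n * t), hn.2.trans_le (min_le_right _ _), fun j hj hjn l => ?_⟩
  · by_contra hlt
    exact absurd (hε' n hn.1 (by omega)) (not_le.2 (hn.2.trans_le (min_le_left _ _)))
  · have h := hmin j hjn
    simp only [not_and, not_lt] at h
    exact hn.2.trans_le ((h hj).trans (round_le _ l))

namespace CircleDeg1Lift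

theorem units_pow_add_apply (g : CircleDeg1Liftˣ) (i j : ℤ) (x : ℝ) :
    (g ^ (i + j)) x = (g ^ i) ((g ^ j) x) := by
  rw [zpow_add, Units.val_mul, mul_apply]

theorem units_zpow_zpow_apply (g : CircleDeg1Liftˣ) {i j k : ℤ} (h : i + j = k) (x : ℝ) :
    (g ^ i) ((g ^ j) x) = (g ^ k) x := by
  rw [← h, units_pow_add_apply]

theorem units_map_add_int (g : CircleDeg1Liftˣ) (x : ℝ) (m : ℤ) : g (x + m) = g x + m :=
  (g : CircleDeg1Lift).map_add_int x m

/-- The order of the points `gᵏ(u) + a` on the line is that of the numbers `k τ + a`. -/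
theorem mul_translationNumber_add_le {g : CircleDeg1Liftˣ} {k k' a b : ℤ} {u : ℝ}
    (h : (g ^ k) u + a ≤ (g ^ k') u + b) :
    k * translationNumber (g : CircleDeg1Lift) + a ≤
      k' * translationNumber (g : CircleDeg1Lift) + b := by
  have h1 := translationNumber_zpow g (k' - k)
  have h2 : ((a - b : ℤ) : ℝ) ≤
      translationNumber ((g ^ (k' - k) : CircleDeg1Liftˣ) : CircleDeg1Lift) := by
    apply le_translationNumber_of_add_int_le (x := (g ^ k) u)
    rw [← units_pow_add_apply, sub_add_cancel]
    push_cast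
    linarith
  rw [h1] at h2
  push_cast at h2
  linarith

/-- A point of the orbit of `u` between `u` and `gⁿ(u) + m` belongs to a translation at most
as large as that of `gⁿ + m`. -/
theorem abs_le_of_between {g : CircleDeg1Liftˣ} {n : ℤ} {m j l : ℤ} {u : ℝ}
    (h : u ≤ (g ^ j) u + l ∧ (g ^ j) u + l ≤ (g ^ n) u + m ∨
      (g ^ n) u + m ≤ (g ^ j) u + l ∧ (g ^ j) u + l ≤ u) :
    |j * translationNumber (g : CircleDeg1Lift) + l| ≤
      |n * translationNumber (g : CircleDeg1Lift) + m| := by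
  rcases h with ⟨h1, h2⟩ | ⟨h1, h2⟩
  · have h1' := mul_translationNumber_add_le (g := g) (k := 0) (a := 0) (by simpa using h1)
    have h2' := mul_translationNumber_add_le h2
    norm_num at h1'
    rw [abs_of_nonneg h1', abs_of_nonneg (h1'.trans h2')]
    exact h2'
  · have h1' := mul_translationNumber_add_le h1
    have h2' := mul_translationNumber_add_le (g := g) (k' := 0) (b := 0) (by simpa using h2)
    norm_num at h2'
    rw [abs_of_nonpos h2', abs_of_nonpos (h1'.trans h2')]
    linarith

/-- The first `n` images of the arc spanned by a closest return are disjoint on the circle. The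
arc runs from `gⁱ(x)` to `gⁱ⁻ⁿ(x) + m`, in whichever direction. -/
theorem disjoint_arcs {g : CircleDeg1Liftˣ} {n : ℕ} {m : ℤ}
    (hne : (n * translationNumber (g : CircleDeg1Lift) - m : ℝ) ≠ 0)
    (hmin : ∀ j : ℕ, 0 < j → j < n → ∀ l : ℤ,
      |n * translationNumber (g : CircleDeg1Lift) - m| <
        |j * translationNumber (g : CircleDeg1Lift) - l|)
    (x : ℝ) {i i' : ℕ} (hi : i < n) (hi' : i' < n) (hii : i ≠ i') :
    Disjoint
      (((↑) : ℝ → UnitAddCircle) '' Set.Ioo (min ((g ^ (i : ℤ)) x) ((g ^ (i - n : ℤ)) x + m))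
        (max ((g ^ (i : ℤ)) x) ((g ^ (i - n : ℤ)) x + m)))
      (((↑) : ℝ → UnitAddCircle) '' Set.Ioo (min ((g ^ (i' : ℤ)) x) ((g ^ (i' - n : ℤ)) x + m))
        (max ((g ^ (i' : ℤ)) x) ((g ^ (i' - n : ℤ)) x + m))) := by
  set t := translationNumber (g : CircleDeg1Lift) with ht
  have hmin' : ∀ j : ℤ, j ≠ 0 → |j| < n → ∀ l : ℤ, ¬ |j * t + l| ≤ |(-n : ℤ) * t + m| := by
    intro j hj hjn l
    rw [not_le]
    have e : |((-n : ℤ) : ℝ) * t + m| = |n * t - m| := by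
      rw [← abs_neg]; congr 1; push_cast; ring
    rw [e]
    rcases Int.eq_nat_or_neg j with ⟨k, rfl | rfl⟩
    · have := hmin k (by omega) (by simpa using hjn) (-l)
      simpa using this
    · have := hmin k (by omega) (by simpa using hjn) l
      rw [← abs_neg (k * t - l)] at this
      refine this.trans_eq ?_
      congr 1; push_cast; ring
  rw [Set.disjoint_left]
  rintro _ ⟨z, hz, rfl⟩ ⟨z', hz', hzz⟩
  obtain ⟨k, rfl⟩ := UnitAddCircle.coe_eq_coe_iff.1 hzz
  -- `w` and `w'` are starting points of two arcs on the line that share the point `z' + k`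
  set w := (g ^ (i : ℤ)) x with hw
  set w' := (g ^ (i' : ℤ)) x + k with hw'
  have e1 : (g ^ (i - n : ℤ)) x = (g ^ (-n : ℤ)) w := by
    rw [hw, units_zpow_zpow_apply g (k := i - n) (by ring)]
  have e2 : (g ^ (i' - n : ℤ)) x + k = (g ^ (-n : ℤ)) w' := by
    rw [hw', units_map_add_int, units_zpow_zpow_apply g (k := i' - n) (by ring)]
  have e3 : (g ^ (i' - i : ℤ)) w + k = w' := by
    rw [hw, hw', units_zpow_zpow_apply g (by ring)]
  have e4 : (g ^ (i - i' : ℤ)) w' + (-k : ℤ) = w := by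
    rw [hw, hw', units_map_add_int, units_zpow_zpow_apply g (k := i) (by ring)]
    push_cast
    rw [add_neg_cancel_right]
  have hz2 : z' + k ∈ Set.Ioo (min w' ((g ^ (-n : ℤ)) w' + m))
      (max w' ((g ^ (-n : ℤ)) w' + m)) := by
    rw [← e2, hw', add_right_comm, min_add_add_right, max_add_add_right]
    exact ⟨by linarith [hz'.1], by linarith [hz'.2]⟩
  rw [e1] at hz
  have hj1 : (i' - i : ℤ) ≠ 0 := by omega
  have hj2 : |(i' - i : ℤ)| < n := by rw [abs_lt]; omega
  have hj3 : (i - i' : ℤ) ≠ 0 := by omega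
  have hj4 : |(i - i' : ℤ)| < n := by rw [abs_lt]; omega
  have sgn : ∀ v, (v ≤ (g ^ (-n : ℤ)) v + m → 0 < (-n : ℤ) * t + m) ∧
      ((g ^ (-n : ℤ)) v + m ≤ v → (-n : ℤ) * t + m < 0) := by
    intro v
    have hne' : ((-n : ℤ) : ℝ) * t + m ≠ 0 := by
      intro h; apply hne; push_cast at h; linarith
    constructor
    · intro h
      have := mul_translationNumber_add_le (g := g) (k := 0) (a := 0) (k' := -n) (b := m) (u := v)
        (by simpa using h)
      norm_num at this
      exact lt_of_le_of_ne (by simpa using this) hne'.symm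
    · intro h
      have := mul_translationNumber_add_le (g := g) (k := -n) (a := m) (k' := 0) (b := 0) (u := v)
        (by simpa using h)
      norm_num at this
      exact lt_of_le_of_ne (by simpa using this) hne'
  rcases le_total w ((g ^ (-n : ℤ)) w + m) with h1 | h1 <;>
    rcases le_total w' ((g ^ (-n : ℤ)) w' + m) with h2 | h2
  · rw [min_eq_left h1, max_eq_right h1] at hz
    rw [min_eq_left h2, max_eq_right h2] at hz2
    rcases le_total w w' with h | h
    · exact hmin' _ hj1 hj2 k (abs_le_of_between (u := w) (Or.inl
        ⟨by rw [e3]; exact h, by rw [e3]; exact (hz2.1.trans hz.2).le⟩))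
    · exact hmin' _ hj3 hj4 (-k) (abs_le_of_between (u := w') (Or.inl
        ⟨by rw [e4]; exact h, by rw [e4]; exact (hz.1.trans hz2.2).le⟩))
  · exact absurd ((sgn w).1 h1) ((sgn w').2 h2).not_gt
  · exact absurd ((sgn w').1 h2) ((sgn w).2 h1).not_gt
  · rw [min_eq_right h1, max_eq_left h1] at hz
    rw [min_eq_right h2, max_eq_left h2] at hz2
    rcases le_total w w' with h | h
    · exact hmin' _ hj3 hj4 (-k) (abs_le_of_between (u := w') (Or.inr
        ⟨by rw [e4]; exact (hz2.1.trans hz.2).le, by rw [e4]; exact h⟩))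
    · exact hmin' _ hj1 hj2 k (abs_le_of_between (u := w) (Or.inr
        ⟨by rw [e3]; exact (hz.1.trans hz2.2).le, by rw [e3]; exact h⟩))

open MeasureTheory in
/-- A rationality criterion. The function `ψ` plays the role of the logarithm of a derivative, with
variation controlled by the measure `μ`, and `H` is a height along the orbit of `x` that increases
by `ψ` up to finitely many errors. If the translation number were irrational, the orbit would be
injective modulo `1`, so the heights would tend to infinity in both directions; yet `H n + H (-n)`
stays bounded along the times `n` of closest return, because it is up to a constant the sum of the
variations of `ψ` along `n` disjoint arcs. The set `S` only has to contain the orbit, so that `ψ`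
may misbehave elsewhere. -/
theorem not_irrational_translationNumber (g : CircleDeg1Liftˣ) (x : ℝ) (ψ : ℝ → ℝ)
    (hper : ∀ y, ∀ m : ℤ, ψ (y + m) = ψ y)
    (μ : Measure UnitAddCircle) [IsFiniteMeasure μ] (S : Set ℝ)
    (hS : ∀ i m : ℤ, (g ^ i) x + m ∈ S)
    (hμ : ∀ a ∈ S, ∀ b ∈ S, a < b → b < a + 1 →
      |ψ b - ψ a| ≤ μ.real (((↑) : ℝ → UnitAddCircle) '' Set.Ioo a b))
    (H : ℤ → ℝ)
    (hH : Function.Injective (fun i : ℤ => (((g ^ i) x : ℝ) : UnitAddCircle)) →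
      Tendsto H cofinite atTop ∧ {i : ℤ | H (i + 1) - H i ≠ ψ ((g ^ i) x)}.Finite) :
    ¬ Irrational (translationNumber (g : CircleDeg1Lift)) := by
  intro hirr
  set t := translationNumber (g : CircleDeg1Lift) with ht
  have hinj : Function.Injective (fun i : ℤ => (((g ^ i) x : ℝ) : UnitAddCircle)) := by
    intro i j hij
    obtain ⟨l, hl⟩ := UnitAddCircle.coe_eq_coe_iff.1 hij
    have h1 := mul_translationNumber_add_le (g := g) (k := j) (a := 0) (k' := i) (b := l) (u := x)
      (by simpa using hl.le)
    have h2 := mul_translationNumber_add_le (g := g) (k := i) (a := l) (k' := j) (b := 0) (u := x)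
      (by simpa using hl.ge)
    rw [← ht] at h1 h2
    push_cast at h1 h2
    by_contra hne
    have h3 : ((j - i : ℤ) : ℝ) * t = l := by push_cast; linarith
    exact (hirr.intCast_mul (m := j - i) (by omega)).ne_int l h3
  obtain ⟨hH', hψ⟩ := hH hinj
  set E : ℤ → ℝ := fun i => H (i + 1) - H i - ψ ((g ^ i) x) with hE
  set C : ℝ := ∑ i ∈ hψ.toFinset, |E i| with hC
  have hsumE : ∀ s : Finset ℤ, ∑ i ∈ s, |E i| ≤ C := by
    intro s
    rw [hC, ← Finset.sum_filter_ne_zero]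
    refine Finset.sum_le_sum_of_subset_of_nonneg ?_ fun _ _ _ => abs_nonneg _
    intro i hi
    rw [Finset.mem_filter] at hi
    simp only [Set.Finite.mem_toFinset, Set.mem_ofPred_eq]
    intro h
    apply hi.2
    simp [hE, h]
  obtain ⟨N, hN⟩ : ∃ N : ℤ, 0 ≤ N ∧ ∀ i : ℤ, N ≤ |i| →
      H 0 + C + μ.real Set.univ + 1 ≤ H i := by
    have hf : {i : ℤ | ¬ (H 0 + C + μ.real Set.univ + 1 ≤ H i)}.Finite :=
      hH'.eventually (eventually_ge_atTop _)
    obtain ⟨B, hB⟩ := (hf.image (fun i => |i|)).bddAbove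
    refine ⟨max 0 (B + 1), le_max_left _ _, fun i hi => ?_⟩
    by_contra hcon
    have h1 := hB ⟨i, hcon, rfl⟩
    have h2 := (le_max_right 0 (B + 1)).trans hi
    simp only at h1
    omega
  obtain ⟨n, hNn, hn, m, hm1, hmin⟩ := hirr.exists_closest_return N.toNat
  have hne : (n * t - m : ℝ) ≠ 0 := sub_ne_zero.2 ((hirr.natCast_mul hn.ne').ne_int m)
  have hHn := hN.2 n (by rw [abs_of_nonneg (by positivity)]; omega)
  have hHn' := hN.2 (-n) (by rw [abs_neg, abs_of_nonneg (by positivity)]; omega)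
  -- the variation of `ψ` along the disjoint arcs
  have hvar : ∑ i ∈ Finset.range n, |ψ ((g ^ (i : ℤ)) x) - ψ ((g ^ (i - n : ℤ)) x)| ≤
      μ.real Set.univ := by
    set A : ℕ → Set UnitAddCircle := fun i => ((↑) : ℝ → UnitAddCircle) ''
      Set.Ioo (min ((g ^ (i : ℤ)) x) ((g ^ (i - n : ℤ)) x + m))
        (max ((g ^ (i : ℤ)) x) ((g ^ (i - n : ℤ)) x + m)) with hA
    have hle : ∀ i ∈ Finset.range n,
        |ψ ((g ^ (i : ℤ)) x) - ψ ((g ^ (i - n : ℤ)) x)| ≤ μ.real (A i) := by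
      intro i _
      rw [← hper ((g ^ (i - n : ℤ)) x) m]
      have m1 : (g ^ (i : ℤ)) x ∈ S := by simpa using hS i 0
      have m2 := hS (i - n) m
      have l1 : ¬ (g ^ (i : ℤ)) x + 1 ≤ (g ^ (i - n : ℤ)) x + m := by
        intro h
        have := mul_translationNumber_add_le (g := g) (k := i) (a := 1) (by simpa using h)
        rw [abs_lt] at hm1
        push_cast at this
        linarith [hm1.1, hm1.2]
      have l2 : ¬ (g ^ (i - n : ℤ)) x + m + 1 ≤ (g ^ (i : ℤ)) x := by
        intro h
        have := mul_translationNumber_add_le (g := g) (k := i - n) (a := m + 1) (k' := i) (b := 0)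
          (u := x) (by push_cast; linarith)
        rw [abs_lt] at hm1
        push_cast at this
        linarith [hm1.1, hm1.2]
      rw [not_le] at l1 l2
      simp only [hA]
      rcases lt_trichotomy ((g ^ (i : ℤ)) x) ((g ^ (i - n : ℤ)) x + m) with h | h | h
      · rw [min_eq_left h.le, max_eq_right h.le, abs_sub_comm]
        exact hμ _ m1 _ m2 h l1
      · rw [h]; simp
      · rw [min_eq_right h.le, max_eq_left h.le]
        exact hμ _ m2 _ m1 h l2
    refine (Finset.sum_le_sum hle).trans ?_
    rw [← measureReal_biUnion_finset]
    · exact measureReal_mono (Set.subset_univ _)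
    · intro i hi i' hi' hii
      exact disjoint_arcs hne hmin x (Finset.mem_range.1 hi) (Finset.mem_range.1 hi') hii
    · intro i _
      exact (QuotientAddGroup.isOpenMap_coe _ isOpen_Ioo).measurableSet
  -- telescoping
  have h1 : ∑ i ∈ Finset.range n, (H ((i + 1 : ℕ) : ℤ) - H (i : ℕ)) = H n - H 0 :=
    Finset.sum_range_sub (fun i : ℕ => H i) n
  have h2 : ∑ i ∈ Finset.range n, (H ((i + 1 : ℕ) - n : ℤ) - H ((i : ℕ) - n : ℤ)) =
      H 0 - H (-n) := by
    rw [Finset.sum_range_sub (fun i : ℕ => H (i - n)) n]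
    simp
  have h3 : ∑ i ∈ Finset.range n, |E i| + ∑ i ∈ Finset.range n, |E (i - n)| ≤ C := by
    have i1 : ∑ i ∈ Finset.range n, |E i| =
        ∑ i ∈ (Finset.range n).map ⟨fun i : ℕ => (i : ℤ), Nat.cast_injective⟩, |E i| := by
      rw [Finset.sum_map]; rfl
    have i2 : ∑ i ∈ Finset.range n, |E (i - n)| =
        ∑ i ∈ (Finset.range n).map ⟨fun i : ℕ => (i - n : ℤ), fun a b h => by simpa using h⟩,
          |E i| := by
      rw [Finset.sum_map]; rfl
    rw [i1, i2, ← Finset.sum_union]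
    · exact hsumE _
    · rw [Finset.disjoint_left]
      simp only [Finset.mem_map, Finset.mem_range, Function.Embedding.coeFn_mk]
      rintro _ ⟨a, ha, rfl⟩ ⟨b, hb, h⟩
      change (b - n : ℤ) = a at h
      omega
  have h4 : (H n - H 0) - (H 0 - H (-n)) ≤ ∑ i ∈ Finset.range n,
      (|ψ ((g ^ (i : ℤ)) x) - ψ ((g ^ (i - n : ℤ)) x)| + (|E i| + |E (i - n)|)) := by
    rw [← h1, ← h2, ← Finset.sum_sub_distrib]
    refine Finset.sum_le_sum fun i _ => ?_
    have e1 : H ((i + 1 : ℕ) : ℤ) - H (i : ℕ) = E i + ψ ((g ^ (i : ℤ)) x) := by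
      simp only [hE]; push_cast; ring
    have e2 : H ((i + 1 : ℕ) - n : ℤ) - H ((i : ℕ) - n : ℤ) =
        E (i - n) + ψ ((g ^ (i - n : ℤ)) x) := by
      simp only [hE]
      rw [show ((i + 1 : ℕ) - n : ℤ) = i - n + 1 by push_cast; ring]; ring
    rw [e1, e2]
    linarith [le_abs_self (E i), neg_abs_le (E (i - n)),
      le_abs_self (ψ ((g ^ (i : ℤ)) x) - ψ ((g ^ (i - n : ℤ)) x))]
  rw [Finset.sum_add_distrib, Finset.sum_add_distrib] at h4
  have hC0 : 0 ≤ C := Finset.sum_nonneg fun _ _ => abs_nonneg _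
  have hμ0 : 0 ≤ μ.real Set.univ := measureReal_nonneg
  linarith

end CircleDeg1Lift

/-- The form in which the criterion is applied to a homeomorphism of the circle. -/
theorem exists_rat_hasRotationNumber {f : UnitAddCircle ≃ₜ UnitAddCircle} {G : CircleDeg1Liftˣ}
    (hG : IsCircleLift f G)
    (h : ¬ Irrational (CircleDeg1Lift.translationNumber (G : CircleDeg1Lift))) :
    ∃ r : ℚ, HasRotationNumber f (((r : ℝ)) : UnitAddCircle) := by
  rw [Irrational, not_not] at h
  obtain ⟨r, hr⟩ := h
  exact ⟨r, hr ▸ hasRotationNumber_translationNumber hG⟩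

/-! ### Dyadic rationals and the local form of elements of Thompson's group -/

/-- The dyadic rational numbers, as real numbers. -/
def IsDyadic (x : ℝ) : Prop := ∃ (p : ℤ) (n : ℕ), x = p / 2 ^ n

namespace IsDyadic

theorem intCast (p : ℤ) : IsDyadic p := ⟨p, 0, by simp⟩

theorem add {x y : ℝ} (hx : IsDyadic x) (hy : IsDyadic y) : IsDyadic (x + y) := by
  obtain ⟨p, n, rfl⟩ := hx
  obtain ⟨q, m, rfl⟩ := hy
  refine ⟨p * 2 ^ m + q * 2 ^ n, n + m, ?_⟩
  push_cast
  rw [pow_add]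
  field_simp

theorem neg {x : ℝ} (hx : IsDyadic x) : IsDyadic (-x) := by
  obtain ⟨p, n, rfl⟩ := hx
  exact ⟨-p, n, by push_cast; ring⟩

theorem sub {x y : ℝ} (hx : IsDyadic x) (hy : IsDyadic y) : IsDyadic (x - y) := by
  rw [sub_eq_add_neg]
  exact hx.add hy.neg

theorem mul {x y : ℝ} (hx : IsDyadic x) (hy : IsDyadic y) : IsDyadic (x * y) := by
  obtain ⟨p, n, rfl⟩ := hx
  obtain ⟨q, m, rfl⟩ := hy
  refine ⟨p * q, n + m, ?_⟩
  push_cast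
  rw [pow_add]
  field_simp

theorem two_zpow (k : ℤ) : IsDyadic (2 ^ k) := by
  rcases Int.eq_nat_or_neg k with ⟨n, rfl | rfl⟩
  · exact ⟨2 ^ n, 0, by simp⟩
  · exact ⟨1, n, by simp⟩

theorem two_zpow_mul_iff {k : ℤ} {x : ℝ} : IsDyadic (2 ^ k * x) ↔ IsDyadic x := by
  refine ⟨fun h => ?_, (two_zpow k).mul⟩
  have := (two_zpow (-k)).mul h
  rwa [← mul_assoc, ← zpow_add₀ two_ne_zero, neg_add_cancel, zpow_zero, one_mul] at this

theorem add_iff_left {x y : ℝ} (hy : IsDyadic y) : IsDyadic (x + y) ↔ IsDyadic x :=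
  ⟨fun h => by simpa using h.sub hy, fun h => h.add hy⟩

theorem not_third : ¬ IsDyadic (1 / 3) := by
  rintro ⟨p, n, h⟩
  field_simp at h
  have h' : (2 : ℤ) ^ n = 3 * p := by exact_mod_cast h
  have h3 : (3 : ℤ) ∣ 2 ^ n := ⟨p, h'⟩
  have := Int.prime_three.dvd_of_dvd_pow h3
  omega

/-- Every nonempty open interval contains a dyadic rational. -/
theorem exists_mem_Ioo {a b : ℝ} (hab : a < b) : ∃ z ∈ Set.Ioo a b, IsDyadic z := by
  obtain ⟨n, hn⟩ := exists_pow_lt_of_lt_one (sub_pos.2 hab) (show (1 / 2 : ℝ) < 1 by norm_num)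
  have h2 : (0 : ℝ) < 2 ^ n := by positivity
  rw [one_div, inv_pow] at hn
  have hn' : 1 < (b - a) * 2 ^ n := by
    rwa [inv_lt_iff_one_lt_mul₀ h2] at hn
  refine ⟨(⌊a * 2 ^ n⌋ + 1 : ℤ) / 2 ^ n, ⟨?_, ?_⟩, ⟨_, n, rfl⟩⟩
  · rw [lt_div_iff₀ h2]
    push_cast
    exact Int.lt_floor_add_one _
  · rw [div_lt_iff₀ h2]
    push_cast
    nlinarith [Int.floor_le (a * 2 ^ n)]

end IsDyadic

theorem coe_mem_dyadicPoints {x : ℝ} : (x : UnitAddCircle) ∈ dyadicPoints ↔ IsDyadic x := by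
  constructor
  · rintro ⟨p, q, h⟩
    obtain ⟨n, hn⟩ := UnitAddCircle.coe_eq_coe_iff.1 h.symm
    rw [hn]
    exact ((IsDyadic.intCast p).mul (IsDyadic.two_zpow q)).add (IsDyadic.intCast n)
  · rintro ⟨p, n, rfl⟩
    exact ⟨p, -n, by rw [zpow_neg, zpow_natCast]; rfl⟩

/-- A continuous lift of an element of Thompson's group is affine, with a slope that is a power of
`2`, on every interval that avoids the break points. -/
theorem IsCircleLift.exists_affine {f : UnitAddCircle ≃ₜ UnitAddCircle} {g : ℝ → ℝ}
    (hg : IsCircleLift f g) {a b : ℝ} {k : ℤ} {c : ℝ}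
    (h : ∀ x ∈ Set.Ioo a b, f (x : UnitAddCircle) = (((2 : ℝ) ^ k * x + c : ℝ) : UnitAddCircle)) :
    ∃ c : ℝ, ∀ x ∈ Set.Ioo a b, g x = 2 ^ k * x + c := by
  obtain ⟨n, hn⟩ := exists_int_forall_eq_of_isPreconnected (h := fun x => g x - (2 ^ k * x + c))
    (isPreconnected_Ioo (a := a) (b := b))
    ((hg.1.sub (by fun_prop)).continuousOn) (fun x hx => by
      obtain ⟨n, hn⟩ := UnitAddCircle.coe_eq_coe_iff.1 ((hg.2 x).trans (h x hx)).symm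
      exact ⟨n, by rw [hn]; ring⟩)
  exact ⟨c + n, fun x hx => by linarith [hn x hx]⟩

theorem exists_Ioo_avoiding {B : Set UnitAddCircle} (hB : B.Finite) {x : ℝ}
    (hx : (x : UnitAddCircle) ∉ B) :
    ∃ ε > 0, ∀ y ∈ Set.Ioo (x - ε) (x + ε), (y : UnitAddCircle) ∉ B := by
  have ho : IsOpen (((↑) : ℝ → UnitAddCircle) ⁻¹' Bᶜ) :=
    hB.isClosed.isOpen_compl.preimage (AddCircle.continuous_mk' 1)
  obtain ⟨ε, hε, h⟩ := Metric.isOpen_iff.1 ho x hx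
  refine ⟨ε, hε, fun y hy => ?_⟩
  rw [Real.ball_eq_Ioo] at h
  exact h hy

/-- Elements of Thompson's group preserve orientation, because they have an affine piece of positive
slope. -/
theorem exists_unit_of_mem_thompsonT {f : UnitAddCircle ≃ₜ UnitAddCircle} (hf : f ∈ thompsonT) :
    ∃ G : CircleDeg1Liftˣ, IsCircleLift f G := by
  obtain ⟨g, hg⟩ := exists_isCircleLift f
  suffices StrictMono g by
    obtain ⟨G, hG⟩ := hg.exists_unit this
    have : ⇑(G : CircleDeg1Lift) = g := funext hG
    exact ⟨G, this ▸ hg⟩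
  refine hg.strictMono_or_strictAnti.resolve_right fun hanti => ?_
  obtain ⟨-, B, hB, hBd, haff⟩ := hf
  obtain ⟨ε, hε, h⟩ := exists_Ioo_avoiding hB
    (fun h => IsDyadic.not_third (coe_mem_dyadicPoints.1 (hBd h)))
  obtain ⟨k, c, hkc⟩ := haff _ _ h
  obtain ⟨c', hc'⟩ := hg.exists_affine hkc
  have m1 : (1 / 3 : ℝ) ∈ Set.Ioo (1 / 3 - ε) (1 / 3 + ε) := by constructor <;> linarith
  have m2 : (1 / 3 + ε / 2 : ℝ) ∈ Set.Ioo (1 / 3 - ε) (1 / 3 + ε) := by constructor <;> linarith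
  have := hanti (show (1 / 3 : ℝ) < 1 / 3 + ε / 2 by linarith)
  rw [hc' _ m1, hc' _ m2] at this
  have h2 : (0 : ℝ) < 2 ^ k := by positivity
  nlinarith

/-- Near `x`, the map `g` is affine with slope `2 ^ k`, where `|k| ≤ M`, and with translation part
a dyadic rational of denominator `2 ^ M`. -/
def IsLocallyDyadicAffineAt (g : ℝ → ℝ) (M : ℕ) (x : ℝ) : Prop :=
  ∃ (k C : ℤ) (a b : ℝ), |k| ≤ M ∧ x ∈ Set.Ioo a b ∧
    ∀ y ∈ Set.Ioo a b, g y = 2 ^ k * y + C / 2 ^ M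

theorem IsLocallyDyadicAffineAt.mono {g : ℝ → ℝ} {M N : ℕ} {x : ℝ} (hMN : M ≤ N)
    (h : IsLocallyDyadicAffineAt g M x) : IsLocallyDyadicAffineAt g N x := by
  obtain ⟨k, C, a, b, hk, hx, h⟩ := h
  refine ⟨k, C * 2 ^ (N - M), a, b, by omega, hx, fun y hy => ?_⟩
  rw [h y hy]
  congr 1
  have : (2 : ℝ) ^ N = 2 ^ (N - M) * 2 ^ M := by rw [← pow_add]; congr 1; omega
  rw [this]
  push_cast
  field_simp

section ThompsonElement

variable {f : UnitAddCircle ≃ₜ UnitAddCircle} {G : CircleDeg1Liftˣ} {B : Set UnitAddCircle}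

theorem isDyadic_lift_iff (hG : IsCircleLift f G) (hf : f '' dyadicPoints = dyadicPoints) {x : ℝ} :
    IsDyadic (G x) ↔ IsDyadic x := by
  rw [← coe_mem_dyadicPoints, ← coe_mem_dyadicPoints, hG.2]
  nth_rewrite 1 [← hf]
  exact f.injective.mem_set_image

theorem exists_isLocallyDyadicAffineAt_of_Ioo (hG : IsCircleLift f G)
    (hf : f '' dyadicPoints = dyadicPoints)
    (haff : ∀ a b : ℝ, (∀ x ∈ Set.Ioo a b, (x : UnitAddCircle) ∉ B) →
        ∃ (k : ℤ) (c : ℝ), ∀ x ∈ Set.Ioo a b,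
          f (x : UnitAddCircle) = (((2 : ℝ) ^ k * x + c : ℝ) : UnitAddCircle))
    {a b : ℝ} (h : ∀ x ∈ Set.Ioo a b, (x : UnitAddCircle) ∉ B) :
    ∃ M, ∀ x ∈ Set.Ioo a b, IsLocallyDyadicAffineAt G M x := by
  rcases le_or_gt b a with hab | hab
  · exact ⟨0, by simp [Set.Ioo_eq_empty (not_lt.2 hab)]⟩
  obtain ⟨k, c, hkc⟩ := haff _ _ h
  obtain ⟨c', hc'⟩ := hG.exists_affine hkc
  obtain ⟨z, hz, hzd⟩ := IsDyadic.exists_mem_Ioo hab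
  have hcd : IsDyadic c' := by
    have h1 := (isDyadic_lift_iff hG hf).2 hzd
    rw [hc' z hz, add_comm] at h1
    exact (IsDyadic.add_iff_left ((IsDyadic.two_zpow k).mul hzd)).1 h1
  obtain ⟨C, n, rfl⟩ := hcd
  refine ⟨max n k.natAbs, fun x hx => ?_⟩
  have hn : (2 : ℝ) ^ (max n k.natAbs) = 2 ^ (max n k.natAbs - n) * 2 ^ n := by
    rw [← pow_add]; congr 1; omega
  refine ⟨k, C * 2 ^ (max n k.natAbs - n), a, b, by rw [Int.abs_eq_natAbs]; omega, hx,
    fun y hy => ?_⟩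
  rw [hc' y hy, hn]
  push_cast
  field_simp

/-- The local affine pieces have uniformly bounded slopes and denominators, by compactness of a
period. -/
theorem exists_forall_isLocallyDyadicAffineAt (hG : IsCircleLift f G)
    (hf : f '' dyadicPoints = dyadicPoints) (hB : B.Finite)
    (haff : ∀ a b : ℝ, (∀ x ∈ Set.Ioo a b, (x : UnitAddCircle) ∉ B) →
        ∃ (k : ℤ) (c : ℝ), ∀ x ∈ Set.Ioo a b,
          f (x : UnitAddCircle) = (((2 : ℝ) ^ k * x + c : ℝ) : UnitAddCircle)) :
    ∃ M, ∀ x : ℝ, (x : UnitAddCircle) ∉ B → IsLocallyDyadicAffineAt G M x := by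
  have hcpt : ∃ M, ∀ x ∈ Set.Icc (0 : ℝ) 1, (x : UnitAddCircle) ∉ B →
      IsLocallyDyadicAffineAt G M x := by
    refine isCompact_Icc.induction_on (p := fun s : Set ℝ => ∃ M, ∀ x ∈ s, (x : UnitAddCircle) ∉ B →
      IsLocallyDyadicAffineAt G M x) ⟨0, by simp⟩ ?_ ?_ ?_
    · rintro s t hst ⟨M, hM⟩
      exact ⟨M, fun x hx => hM x (hst hx)⟩
    · rintro s t ⟨M, hM⟩ ⟨N, hN⟩
      refine ⟨max M N, fun x hx hxB => ?_⟩
      rcases hx with hx | hx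
      · exact (hM x hx hxB).mono (le_max_left _ _)
      · exact (hN x hx hxB).mono (le_max_right _ _)
    · intro y _
      obtain ⟨ε, hε, hav⟩ := exists_Ioo_avoiding (B := B \ {(y : UnitAddCircle)})
        (hB.subset Set.sdiff_subset) (x := y) (by simp)
      -- a punctured neighbourhood of `y` without break points
      have hav' : ∀ z, |z - y| < min ε 1 → z ≠ y → (z : UnitAddCircle) ∉ B := by
        intro z hz hzy hzB
        rw [lt_min_iff, abs_lt, abs_lt] at hz
        refine hav z ⟨by linarith [hz.1.1], by linarith [hz.1.2]⟩ ⟨hzB, fun h => hzy ?_⟩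
        obtain ⟨n, hn⟩ := UnitAddCircle.coe_eq_coe_iff.1 h
        have h1 : (n : ℝ) < 1 := by linarith [hz.2.1]
        have h2 : (-1 : ℝ) < n := by linarith [hz.2.2]
        have h3 : n < 1 := by exact_mod_cast h1
        have h4 : -1 < n := by exact_mod_cast h2
        have h5 : n = 0 := by omega
        rw [hn, h5]; simp
      set δ := min ε 1 with hδ
      have hδ0 : 0 < δ := lt_min hε one_pos
      obtain ⟨M₁, hM₁⟩ := exists_isLocallyDyadicAffineAt_of_Ioo hG hf haff (a := y - δ) (b := y)
        (fun x hx => hav' x (by rw [abs_lt]; constructor <;> linarith [hx.1, hx.2]) hx.2.ne)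
      obtain ⟨M₂, hM₂⟩ := exists_isLocallyDyadicAffineAt_of_Ioo hG hf haff (a := y) (b := y + δ)
        (fun x hx => hav' x (by rw [abs_lt]; constructor <;> linarith [hx.1, hx.2]) hx.1.ne')
      obtain ⟨M₃, hM₃⟩ : ∃ M, (y : UnitAddCircle) ∉ B → IsLocallyDyadicAffineAt G M y := by
        by_cases hy : (y : UnitAddCircle) ∈ B
        · exact ⟨0, fun h => absurd hy h⟩
        · obtain ⟨η, hη, h⟩ := exists_Ioo_avoiding hB hy
          obtain ⟨M, hM⟩ := exists_isLocallyDyadicAffineAt_of_Ioo hG hf haff h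
          exact ⟨M, fun _ => hM y (by constructor <;> linarith)⟩
      refine ⟨Set.Ioo (y - δ) (y + δ), mem_nhdsWithin_of_mem_nhds
        (Ioo_mem_nhds (by linarith) (by linarith)), max M₁ (max M₂ M₃), fun x hx hxB => ?_⟩
      rcases lt_trichotomy x y with h | rfl | h
      · exact (hM₁ x ⟨hx.1, h⟩).mono (by omega)
      · exact (hM₃ hxB).mono (by omega)
      · exact (hM₂ x ⟨h, hx.2⟩).mono (by omega)
  obtain ⟨M, hM⟩ := hcpt
  refine ⟨M, fun x hx => ?_⟩
  obtain ⟨k, C, a, b, hk, hmem, h⟩ := hM (Int.fract x)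
    ⟨Int.fract_nonneg x, (Int.fract_lt_one x).le⟩ (by
      rw [← UnitAddCircle.coe_add_int _ ⌊x⌋, Int.fract_add_floor]
      exact hx)
  set n := ⌊x⌋ with hn
  obtain ⟨j, hj⟩ : ∃ j : ℕ, k + M = j := Int.eq_ofNat_of_zero_le (by rw [abs_le] at hk; omega)
  refine ⟨k, C + n * 2 ^ M - n * 2 ^ j, a + n, b + n, hk,
    ⟨by linarith [hmem.1, Int.fract_add_floor x], by linarith [hmem.2, Int.fract_add_floor x]⟩,
    fun y hy => ?_⟩
  have h1 := h (y - n) ⟨by linarith [hy.1], by linarith [hy.2]⟩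
  rw [(G : CircleDeg1Lift).map_sub_int] at h1
  have h2 : (2 : ℝ) ^ j = 2 ^ k * 2 ^ M := by
    rw [← zpow_natCast, ← zpow_natCast, ← hj, zpow_add₀ two_ne_zero]
  push_cast
  rw [h2]
  have h3 : G y = 2 ^ k * (y - n) + C / 2 ^ M + n := by linarith
  rw [h3]
  field_simp
  ring

/-- The logarithm in base `2` of the slope of `g` at `x`. -/
noncomputable def logSlope (g : ℝ → ℝ) (x : ℝ) : ℤ := Int.log 2 (deriv g x)

theorem logSlope_eq {g : ℝ → ℝ} {k : ℤ} {a b c x : ℝ} (hx : x ∈ Set.Ioo a b)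
    (h : ∀ y ∈ Set.Ioo a b, g y = 2 ^ k * y + c) : logSlope g x = k := by
  have h1 : g =ᶠ[𝓝 x] fun y => 2 ^ k * y + c := by
    filter_upwards [Ioo_mem_nhds hx.1 hx.2] with y hy using h y hy
  have h2 : HasDerivAt (fun y : ℝ => (2 : ℝ) ^ k * y + c) (2 ^ k) x := by
    simpa using ((hasDerivAt_id x).const_mul ((2 : ℝ) ^ k)).add_const c
  rw [logSlope, h1.deriv_eq, h2.deriv]
  exact_mod_cast Int.log_zpow (R := ℝ) one_lt_two k

theorem logSlope_add_int (G : CircleDeg1Liftˣ) (x : ℝ) (m : ℤ) :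
    logSlope G (x + m) = logSlope G x := by
  rw [logSlope, logSlope, ← deriv_comp_add_const]
  have : (fun y => G (y + m)) = fun y => G y + m := funext fun y => G.val.map_add_int y m
  rw [this, deriv_add_const]

theorem IsLocallyDyadicAffineAt.abs_logSlope_le {g : ℝ → ℝ} {M : ℕ} {x : ℝ}
    (h : IsLocallyDyadicAffineAt g M x) : |logSlope g x| ≤ M := by
  obtain ⟨k, C, a, b, hk, hx, h⟩ := h
  rwa [logSlope_eq hx h]

theorem logSlope_eq_of_Ioo {g : ℝ → ℝ} {M : ℕ} {a b c : ℝ} {k : ℤ} (hab : a < b)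
    (ha : IsLocallyDyadicAffineAt g M a) (hb : IsLocallyDyadicAffineAt g M b)
    (h : ∀ y ∈ Set.Ioo a b, g y = 2 ^ k * y + c) : logSlope g a = logSlope g b := by
  obtain ⟨k₁, C₁, a₁, b₁, -, ha₁, h₁⟩ := ha
  obtain ⟨k₂, C₂, a₂, b₂, -, hb₂, h₂⟩ := hb
  obtain ⟨y, hy, hy'⟩ := exists_between (lt_min ha₁.2 hab)
  obtain ⟨z, hz, hz'⟩ := exists_between (max_lt hb₂.1 hab)
  rw [lt_min_iff] at hy'
  rw [max_lt_iff] at hz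
  rw [logSlope_eq ha₁ h₁, logSlope_eq hb₂ h₂,
    ← logSlope_eq (x := y) ⟨ha₁.1.trans hy, hy'.1⟩ h₁, logSlope_eq ⟨hy, hy'.2⟩ h,
    ← logSlope_eq (x := z) ⟨hz.1, hz'.trans hb₂.2⟩ h₂, logSlope_eq ⟨hz.2, hz'⟩ h]

open MeasureTheory in
/-- The logarithm of the slope only changes at break points, by at most `2 M` each. -/
theorem abs_logSlope_sub_le {g : ℝ → ℝ} {B : Set UnitAddCircle} (hB : B.Finite) {M : ℕ}
    (haff : ∀ a b : ℝ, (∀ x ∈ Set.Ioo a b, (x : UnitAddCircle) ∉ B) →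
        ∃ (k : ℤ) (c : ℝ), ∀ x ∈ Set.Ioo a b, g x = 2 ^ k * x + c)
    {a b : ℝ} (hab : a < b) (ha : IsLocallyDyadicAffineAt g M a)
    (hb : IsLocallyDyadicAffineAt g M b) :
    |(logSlope g b : ℝ) - logSlope g a| ≤
      (∑ θ ∈ hB.toFinset, (2 * M : ℕ) • Measure.dirac θ : Measure UnitAddCircle).real
        (((↑) : ℝ → UnitAddCircle) '' Set.Ioo a b) := by
  by_cases h : ∀ x ∈ Set.Ioo a b, (x : UnitAddCircle) ∉ B
  · obtain ⟨k, c, hkc⟩ := haff _ _ h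
    rw [logSlope_eq_of_Ioo hab ha hb hkc, sub_self, abs_zero]
    exact measureReal_nonneg
  · push Not at h
    obtain ⟨x, hx, hxB⟩ := h
    set A := ((↑) : ℝ → UnitAddCircle) '' Set.Ioo a b with hA
    have hAm : MeasurableSet A := (QuotientAddGroup.isOpenMap_coe _ isOpen_Ioo).measurableSet
    have h1 : ((2 * M : ℕ) • Measure.dirac (x : UnitAddCircle)).real A = 2 * M := by
      rw [measureReal_def, Measure.smul_apply, Measure.dirac_apply' _ hAm,
        Set.indicator_of_mem (hA ▸ Set.mem_image_of_mem _ hx)]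
      simp
    have h2 : ((2 * M : ℕ) • Measure.dirac (x : UnitAddCircle)).real A ≤
        (∑ θ ∈ hB.toFinset, (2 * M : ℕ) • Measure.dirac θ : Measure UnitAddCircle).real A := by
      rw [measureReal_def, measureReal_def]
      refine ENNReal.toReal_mono (measure_ne_top _ _) ?_
      rw [Measure.finsetSum_apply]
      exact Finset.single_le_sum
        (f := fun θ => ((2 * M : ℕ) • Measure.dirac θ : Measure UnitAddCircle) A)
        (fun _ _ => zero_le) (hB.mem_toFinset.2 hxB)
    rw [h1] at h2
    refine le_trans ?_ h2
    have h3 := ha.abs_logSlope_le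
    have h4 := hb.abs_logSlope_le
    have h5 : |logSlope g b - logSlope g a| ≤ 2 * M := by rw [abs_le] at *; omega
    exact_mod_cast h5

/-! ### Heights of non-dyadic points of `(1/3) ℤ[1/2]` -/

/-- The points of `(1/3) ℤ[1/2]` that are not dyadic. A lift of an element of Thompson's group
permutes them, and they avoid its break points. -/
def dyadicThirds : Set ℝ := {x | ¬ IsDyadic x ∧ IsDyadic (3 * x)}

theorem add_int_mem_dyadicThirds {x : ℝ} (hx : x ∈ dyadicThirds) (m : ℤ) :
    x + m ∈ dyadicThirds := by
  refine ⟨fun h => hx.1 ((IsDyadic.add_iff_left (IsDyadic.intCast m)).1 h), ?_⟩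
  rw [mul_add]
  exact hx.2.add (by exact_mod_cast IsDyadic.intCast (3 * m))

theorem two_zpow_mul_add_mem_dyadicThirds_iff {k : ℤ} {c x : ℝ} (hc : IsDyadic c) :
    2 ^ k * x + c ∈ dyadicThirds ↔ x ∈ dyadicThirds := by
  have h3 : IsDyadic (3 * c) := IsDyadic.mul (by exact_mod_cast IsDyadic.intCast 3) hc
  simp only [dyadicThirds, Set.mem_ofPred_eq]
  rw [IsDyadic.add_iff_left hc, IsDyadic.two_zpow_mul_iff, mul_add, IsDyadic.add_iff_left h3,
    show (3 : ℝ) * (2 ^ k * x) = 2 ^ k * (3 * x) by ring, IsDyadic.two_zpow_mul_iff]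

theorem IsLocallyDyadicAffineAt.mem_dyadicThirds_iff {g : ℝ → ℝ} {M : ℕ} {x : ℝ}
    (h : IsLocallyDyadicAffineAt g M x) : g x ∈ dyadicThirds ↔ x ∈ dyadicThirds := by
  obtain ⟨k, C, a, b, -, hx, h⟩ := h
  rw [h x hx]
  exact two_zpow_mul_add_mem_dyadicThirds_iff ⟨C, M, rfl⟩

/-- A nonzero dyadic rational is an odd integer times a power of `2`. -/
theorem IsDyadic.exists_odd {x : ℝ} (hx : IsDyadic x) (h0 : x ≠ 0) :
    ∃ p m : ℤ, Odd p ∧ x = p * 2 ^ (-m) := by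
  obtain ⟨p, n, rfl⟩ := hx
  have hp : p ≠ 0 := by rintro rfl; simp at h0
  obtain ⟨q, hpq, hq⟩ := (Int.finiteMultiplicity_iff.2
    ⟨show (2 : ℤ).natAbs ≠ 1 by decide, hp⟩).exists_eq_pow_mul_and_not_dvd
  set k := multiplicity 2 p
  refine ⟨q, n - k, Int.not_even_iff_odd.1 (by rwa [even_iff_two_dvd]), ?_⟩
  rw [hpq, neg_sub, zpow_sub₀ two_ne_zero]
  push_cast
  rw [zpow_natCast, zpow_natCast]
  ring

theorem eq_of_odd_mul_two_zpow_eq {p q m n : ℤ} (hp : Odd p) (hq : Odd q)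
    (h : (p : ℝ) * 2 ^ m = q * 2 ^ n) : m = n := by
  wlog hmn : m < n generalizing p q m n
  · rcases (not_lt.1 hmn).lt_or_eq with h' | h'
    · exact (this hq hp h.symm h').symm
    · exact h'.symm
  exfalso
  obtain ⟨j, hj⟩ : ∃ j : ℕ, n = m + (j + 1 : ℕ) := ⟨(n - m - 1).toNat, by omega⟩
  rw [hj, zpow_add₀ two_ne_zero, zpow_natCast, mul_comm ((2 : ℝ) ^ m), ← mul_assoc] at h
  have h1 := mul_right_cancel₀ (by positivity) h
  have h2 : p = q * 2 ^ (j + 1) := by exact_mod_cast h1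
  rw [← Int.not_even_iff_odd] at hp
  exact hp (h2 ▸ (even_two.pow_of_ne_zero j.succ_ne_zero).mul_left q)

/-- Away from small heights, an affine map with slope `2 ^ k` lowers the height, that is the
exponent of `2` in the denominator, by exactly `k`. -/
theorem height_affine_eq {k C p q m n : ℤ} {M : ℕ} {x : ℝ} (hk : |k| ≤ M) (hm : 2 * M < m)
    (hp : Odd p) (hq : Odd q) (hx : 3 * x = p * 2 ^ (-m))
    (hy : 3 * (2 ^ k * x + C / 2 ^ M) = q * 2 ^ (-n)) : n = m - k := by
  rw [abs_le] at hk
  obtain ⟨j, hj⟩ : ∃ j : ℕ, m - k - M = (j + 1 : ℕ) := ⟨(m - k - M - 1).toNat, by omega⟩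
  have h1 : ((p + 3 * C * 2 ^ (j + 1) : ℤ) : ℝ) * 2 ^ (k - m) = q * 2 ^ (-n) := by
    rw [← hy, show 3 * ((2 : ℝ) ^ k * x + C / 2 ^ M) = 2 ^ k * (3 * x) + 3 * C / 2 ^ M by ring, hx]
    have e1 : (2 : ℝ) ^ (k - m) = 2 ^ k * 2 ^ (-m) := by
      rw [sub_eq_add_neg, zpow_add₀ two_ne_zero]
    have e2 : (2 : ℝ) ^ (j + 1) * 2 ^ (k - m) = (2 ^ M)⁻¹ := by
      rw [← zpow_natCast, ← zpow_natCast, ← zpow_neg, ← hj, ← zpow_add₀ two_ne_zero]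
      congr 1; ring
    push_cast
    rw [add_mul, mul_assoc (3 * (C : ℝ)), e2, e1]
    ring
  have h2 : Odd (p + 3 * C * 2 ^ (j + 1)) :=
    hp.add_even ((even_two.pow_of_ne_zero j.succ_ne_zero).mul_left _)
  have := eq_of_odd_mul_two_zpow_eq h2 hq h1
  omega

/-- The rationality criterion applies to the orbit of `1/3`. The height of a point is the exponent
of `2` in its denominator; by finiteness of torsion, only finitely many points of the circle have
bounded height. -/
theorem exists_rat_of_mem_thompsonT {f : UnitAddCircle ≃ₜ UnitAddCircle} (hf : f ∈ thompsonT) :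
    ∃ r : ℚ, HasRotationNumber f (((r : ℝ)) : UnitAddCircle) := by
  obtain ⟨G, hG⟩ := exists_unit_of_mem_thompsonT hf
  obtain ⟨hfd, B, hB, hBd, haff⟩ := hf
  obtain ⟨M, hM⟩ := exists_forall_isLocallyDyadicAffineAt hG hfd hB haff
  have haff' : ∀ a b : ℝ, (∀ x ∈ Set.Ioo a b, (x : UnitAddCircle) ∉ B) →
      ∃ (k : ℤ) (c : ℝ), ∀ x ∈ Set.Ioo a b, G x = 2 ^ k * x + c := by
    intro a b h
    obtain ⟨k, c, hkc⟩ := haff a b h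
    exact ⟨k, hG.exists_affine hkc⟩
  have hloc : ∀ x : ℝ, ¬ IsDyadic x → IsLocallyDyadicAffineAt G M x :=
    fun x hx => hM x fun h => hx (coe_mem_dyadicPoints.1 (hBd h))
  have hmem : ∀ x, G x ∈ dyadicThirds ↔ x ∈ dyadicThirds := by
    intro x
    by_cases hx : IsDyadic x
    · exact ⟨fun h => absurd ((isDyadic_lift_iff hG hfd).2 hx) h.1, fun h => absurd hx h.1⟩
    · exact (hloc x hx).mem_dyadicThirds_iff
  have horb : ∀ i : ℤ, (G ^ i) (1 / 3) ∈ dyadicThirds := by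
    intro i
    induction i using Int.induction_on with
    | zero => exact ⟨IsDyadic.not_third, by simpa using IsDyadic.intCast 1⟩
    | succ i ih =>
      rw [← hmem] at ih
      rwa [← CircleDeg1Lift.units_zpow_zpow_apply G (i := 1) (j := i) (by ring), zpow_one]
    | pred i ih =>
      have e := CircleDeg1Lift.units_zpow_zpow_apply G (i := 1) (j := -i - 1) (k := -i) (by ring)
        (1 / 3)
      rw [zpow_one] at e
      rwa [← hmem, e]
  choose p m hpm hpm' using fun i => (horb i).2.exists_odd (fun h => (horb i).1 (by
    have : (G ^ i) (1 / 3) = (0 : ℤ) := by simpa using h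
    rw [this]; exact IsDyadic.intCast 0))
  refine exists_rat_hasRotationNumber hG ?_
  refine CircleDeg1Lift.not_irrational_translationNumber G (1 / 3) (fun x => -(logSlope G x : ℝ))
    (fun y m => by rw [logSlope_add_int])
    (∑ θ ∈ hB.toFinset, (2 * M : ℕ) • MeasureTheory.Measure.dirac θ) dyadicThirds
    (fun i m => add_int_mem_dyadicThirds (horb i) m) ?_ (fun i => m i) fun hinj => ?_
  · intro a ha b hb hab _
    have := abs_logSlope_sub_le hB haff' hab (hloc a ha.1) (hloc b hb.1)
    rwa [neg_sub_neg, abs_sub_comm]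
  have hfin : ∀ L : ℕ, {i : ℤ | m i ≤ L}.Finite := by
    intro L
    refine Set.Finite.of_finite_image (f := fun i : ℤ => (((G ^ i) (1 / 3) : ℝ) : UnitAddCircle))
      ((AddCircle.finite_torsion (1 : ℝ) (n := 3 * 2 ^ L) (by positivity)).subset ?_) hinj.injOn
    rintro _ ⟨i, hi, rfl⟩
    obtain ⟨j, hj⟩ : ∃ j : ℕ, L - m i = j := Int.eq_ofNat_of_zero_le (sub_nonneg.2 hi)
    change (3 * 2 ^ L) • (((G ^ i) (1 / 3) : ℝ) : UnitAddCircle) = 0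
    rw [← AddCircle.coe_nsmul, AddCircle.coe_eq_zero_iff]
    refine ⟨p i * 2 ^ j, ?_⟩
    rw [nsmul_eq_mul]
    push_cast
    rw [mul_comm (3 : ℝ), mul_assoc, hpm' i, zsmul_eq_mul, mul_one]
    push_cast
    rw [← zpow_natCast, ← zpow_natCast, ← hj, sub_eq_add_neg, zpow_add₀ two_ne_zero]
    ring
  constructor
  · refine tendsto_atTop.2 fun b => ?_
    refine (hfin ⌈b⌉.toNat).subset fun i hi => ?_
    change ¬ b ≤ (m i : ℝ) at hi
    have h1 : (m i : ℝ) < ⌈b⌉ := (not_le.1 hi).trans_le (Int.le_ceil b)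
    have h2 : m i < ⌈b⌉ := by exact_mod_cast h1
    change m i ≤ _
    omega
  · refine (hfin (2 * M)).subset fun i hi => ?_
    by_contra hcon
    have hcon' : 2 * M < m i := by
      change ¬ m i ≤ _ at hcon
      push_cast at hcon
      omega
    refine hi ?_
    obtain ⟨k, C, a, b, hk, hmem', h⟩ := hloc _ (horb i).1
    have h1 := hpm' (i + 1)
    rw [← CircleDeg1Lift.units_zpow_zpow_apply G (i := 1) (j := i) (by ring), zpow_one,
      h _ hmem'] at h1
    have h2 := height_affine_eq hk hcon' (hpm i) (hpm (i + 1)) (hpm' i) h1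
    rw [logSlope_eq hmem' h, h2]
    push_cast
    ring

end ThompsonElement

/-! ### Dyadic homeomorphisms with prescribed rotation number -/

/-- If the rotation number of `f` is `k / N` in lowest terms, the powers of `f` realize all
multiples of `1 / N`. -/
theorem exists_pow_hasRotationNumber {f : UnitAddCircle ≃ₜ UnitAddCircle} {G : CircleDeg1Liftˣ}
    (hG : IsCircleLift f G) {k : ℤ} {N : ℕ} (hN : 0 < N) (hk : IsCoprime k N)
    (ht : CircleDeg1Lift.translationNumber (G : CircleDeg1Lift) = k / N) (p : ℤ) :
    ∃ n : ℕ, HasRotationNumber (f ^ n) ((p / N : ℝ) : UnitAddCircle) := by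
  obtain ⟨a, b, hab⟩ := hk
  have hN' : (N : ℤ) ≠ 0 := by omega
  refine ⟨(p * a % N).toNat, ?_⟩
  have h := hasRotationNumber_translationNumber (hG.pow (p * a % N).toNat)
  convert h using 1
  refine UnitAddCircle.coe_eq_coe_iff.2 ⟨-(p * b + p * a / N * k), ?_⟩
  have h1 : (((p * a % N).toNat : ℤ) : ℝ) = ((p * a - N * (p * a / N) : ℤ) : ℝ) := by
    rw [Int.toNat_of_nonneg (Int.emod_nonneg _ hN'), Int.emod_def]
  rw [Int.cast_natCast] at h1
  have h2 : ((a * k + b * N : ℤ) : ℝ) = 1 := by exact_mod_cast hab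
  have hN0 : (N : ℝ) ≠ 0 := by positivity
  rw [Units.val_pow_eq_pow_val, CircleDeg1Lift.translationNumber_pow, ht, h1]
  generalize p * a / N = c
  push_cast at h2 ⊢
  field_simp
  linear_combination (p : ℝ) * h2

theorem one_mem_thompsonT : (1 : UnitAddCircle ≃ₜ UnitAddCircle) ∈ thompsonT := by
  refine ⟨Set.image_id _, ∅, Set.finite_empty, Set.empty_subset _, fun a b _ => ⟨0, 0, ?_⟩⟩
  intro x _
  simp

theorem mul_mem_thompsonT {f g : UnitAddCircle ≃ₜ UnitAddCircle} (hf : f ∈ thompsonT)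
    (hg : g ∈ thompsonT) : f * g ∈ thompsonT := by
  obtain ⟨hfd, B, hB, hBd, hf⟩ := hf
  obtain ⟨hgd, A, hA, hAd, hg⟩ := hg
  refine ⟨?_, A ∪ g ⁻¹' B, hA.union (hB.preimage g.injective.injOn), ?_, ?_⟩
  · calc (f * g) '' dyadicPoints = f '' (g '' dyadicPoints) := (Set.image_image f g _).symm
      _ = dyadicPoints := by rw [hgd, hfd]
  · refine Set.union_subset hAd fun θ hθ => ?_
    have h := hBd hθ
    rw [← hgd] at h
    exact (g.injective.mem_set_image).1 h
  · intro a b hab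
    obtain ⟨k, c, hkc⟩ := hg a b fun x hx h => hab x hx (Or.inl h)
    have hk : (0 : ℝ) < 2 ^ k := by positivity
    obtain ⟨l, d, hld⟩ := hf (2 ^ k * a + c) (2 ^ k * b + c) (by
      intro y hy
      have hx : (y - c) / 2 ^ k ∈ Set.Ioo a b := by
        refine ⟨?_, ?_⟩
        · rw [lt_div_iff₀ hk]; linarith [hy.1]
        · rw [div_lt_iff₀ hk]; linarith [hy.2]
      intro hyB
      refine hab _ hx (Or.inr ?_)
      rw [Set.mem_preimage, hkc _ hx]
      convert hyB using 2
      field_simp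
      ring)
    refine ⟨l + k, 2 ^ l * c + d, fun x hx => ?_⟩
    change f (g x) = _
    rw [hkc x hx, hld _ ⟨by nlinarith [hx.1], by nlinarith [hx.2]⟩, zpow_add₀ two_ne_zero]
    congr 1
    ring

theorem pow_mem_thompsonT {f : UnitAddCircle ≃ₜ UnitAddCircle} (hf : f ∈ thompsonT) (n : ℕ) :
    f ^ n ∈ thompsonT := by
  induction n with
  | zero => exact one_mem_thompsonT
  | succ n ih => exact mul_mem_thompsonT ih hf

/-- The convex piecewise linear map on `[0, 1]` that carries `0` to `1/2`, `1/2` to `3/4`, and so on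
up to `1 - 2 ^ (-(j + 1))`, which is carried to `1`. -/
noncomputable def dyadicStep (j : ℕ) (t : ℝ) : ℝ :=
  max (t / 2 + 1 / 2) (max (t + 1 / 2 ^ (j + 1)) (2 ^ j * (t - 1) + 3 / 2))

section DyadicStep

variable (j : ℕ)

theorem one_div_two_pow_le_half : (1 : ℝ) / 2 ^ (j + 1) ≤ 1 / 2 := by
  have hK : (1 : ℝ) ≤ 2 ^ j := one_le_pow₀ (by norm_num)
  rw [pow_succ]
  apply one_div_le_one_div_of_le <;> linarith

theorem dyadicStep_strictMono : StrictMono (dyadicStep j) := by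
  intro s t hst
  have h : (0 : ℝ) < 2 ^ j := by positivity
  refine max_lt_max (by linarith) (max_lt_max (by linarith) ?_)
  have := mul_lt_mul_of_pos_left hst h
  linarith

theorem dyadicStep_eq_left {t : ℝ} (ht : t ≤ 1 - 2 * (1 / 2 ^ (j + 1))) :
    dyadicStep j t = t / 2 + 1 / 2 := by
  have hK : (1 : ℝ) ≤ 2 ^ j := one_le_pow₀ (by norm_num)
  have h1 : (2 : ℝ) ^ j * (1 / 2 ^ (j + 1)) = 1 / 2 := by rw [pow_succ]; field_simp
  rw [dyadicStep, max_eq_left]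
  refine max_le (by linarith) ?_
  have h2 := one_div_two_pow_le_half j
  nlinarith [mul_nonneg (show (0 : ℝ) ≤ 2 ^ j - 1 / 2 by linarith) (sub_nonneg.2 ht)]

theorem dyadicStep_eq_middle {t : ℝ} (ht : 1 - 2 * (1 / 2 ^ (j + 1)) ≤ t)
    (ht' : t ≤ 1 - 1 / 2 ^ (j + 1)) : dyadicStep j t = t + 1 / 2 ^ (j + 1) := by
  have hK : (1 : ℝ) ≤ 2 ^ j := one_le_pow₀ (by norm_num)
  have h1 : (2 : ℝ) ^ j * (1 / 2 ^ (j + 1)) = 1 / 2 := by rw [pow_succ]; field_simp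
  rw [dyadicStep, max_eq_right, max_eq_left]
  · nlinarith
  · exact le_max_of_le_left (by linarith)

theorem dyadicStep_eq_right {t : ℝ} (ht : 1 - 1 / 2 ^ (j + 1) ≤ t) :
    dyadicStep j t = 2 ^ j * (t - 1) + 3 / 2 := by
  have hK : (1 : ℝ) ≤ 2 ^ j := one_le_pow₀ (by norm_num)
  have h0 : (0 : ℝ) < 1 / 2 ^ (j + 1) := by positivity
  have h1 : (2 : ℝ) ^ j * (1 / 2 ^ (j + 1)) = 1 / 2 := by rw [pow_succ]; field_simp
  have h2 : t + 1 / 2 ^ (j + 1) ≤ 2 ^ j * (t - 1) + 3 / 2 := by nlinarith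
  rw [dyadicStep, max_eq_right, max_eq_right h2]
  exact le_max_of_le_left (by linarith)

theorem dyadicStep_zero : dyadicStep j 0 = 1 / 2 := by
  rw [dyadicStep_eq_left _ (by linarith [one_div_two_pow_le_half j])]
  norm_num

theorem dyadicStep_one : dyadicStep j 1 = 3 / 2 := by
  have h0 : (0 : ℝ) < 1 / 2 ^ (j + 1) := by positivity
  rw [dyadicStep_eq_right _ (by linarith)]
  norm_num

theorem isDyadic_dyadicStep_iff {t : ℝ} : IsDyadic (dyadicStep j t) ↔ IsDyadic t := by
  have e : ∀ (k : ℤ) (c s : ℝ), IsDyadic c → s = 2 ^ k * t + c → (IsDyadic s ↔ IsDyadic t) := by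
    rintro k c _ hc rfl
    rw [IsDyadic.add_iff_left hc, IsDyadic.two_zpow_mul_iff]
  rcases le_total t (1 - 2 * (1 / 2 ^ (j + 1))) with h | h
  · refine e (-1) (1 / 2) _ ⟨1, 1, by norm_num⟩ ?_
    rw [dyadicStep_eq_left j h]; norm_num; ring
  rcases le_total t (1 - 1 / 2 ^ (j + 1)) with h' | h'
  · refine e 0 (1 / 2 ^ (j + 1)) _ ⟨1, j + 1, by norm_num⟩ ?_
    rw [dyadicStep_eq_middle j h h']; norm_num
  · refine e j (3 / 2 - 2 ^ j) _ ⟨3 - 2 ^ j * 2, 1, by push_cast; ring⟩ ?_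
    rw [dyadicStep_eq_right j h', zpow_natCast]; ring

/-- The extension of `dyadicStep j` to the line, as the lift of a circle homeomorphism. -/
theorem exists_unit_dyadicStep :
    ∃ G : CircleDeg1Liftˣ, ∀ x, G x = dyadicStep j (Int.fract x) + ⌊x⌋ := by
  set g : ℝ → ℝ := fun x => dyadicStep j (Int.fract x) + ⌊x⌋ with hg
  have hmono : StrictMono g := by
    intro x y hxy
    simp only [hg]
    rcases (Int.floor_mono hxy.le).eq_or_lt with h | h
    · rw [h]
      have : Int.fract x < Int.fract y := by
        rw [Int.fract, Int.fract, h]; linarith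
      linarith [dyadicStep_strictMono j this]
    · have h1 : ((⌊x⌋ : ℤ) : ℝ) + 1 ≤ ⌊y⌋ := by exact_mod_cast h
      have h2 := dyadicStep_strictMono j (Int.fract_lt_one x)
      have h3 := (dyadicStep_strictMono j).monotone (Int.fract_nonneg y)
      rw [dyadicStep_one] at h2
      rw [dyadicStep_zero] at h3
      linarith
  have hcont : Continuous g := by
    have h1 : Continuous fun x : ℝ => (fun t => dyadicStep j t - t) (Int.fract x) := by
      refine ContinuousOn.comp_fract'' (f := fun t => dyadicStep j t - t) ?_
        (by rw [dyadicStep_zero, dyadicStep_one]; norm_num)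
      unfold dyadicStep
      fun_prop
    convert h1.add continuous_id using 1
    funext x
    simp only [hg, Pi.add_apply, id]
    linarith [Int.fract_add_floor x]
  let G : CircleDeg1Lift := ⟨⟨g, hmono.monotone⟩, fun x => by
    simp only [hg, Int.fract_add_one, Int.floor_add_one]
    push_cast
    ring⟩
  have hG : ⇑G = g := rfl
  obtain ⟨u, hu⟩ := CircleDeg1Lift.isUnit_iff_bijective.2
    ⟨hG ▸ hmono.injective, G.continuous_iff_surjective.1 (hG ▸ hcont)⟩
  exact ⟨u, fun x => by rw [hu, hG]⟩

theorem mem_thompsonT_of_dyadicStep {f : UnitAddCircle ≃ₜ UnitAddCircle} {G : CircleDeg1Liftˣ}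
    (hf : IsCircleLift f G) (hG : ∀ x, G x = dyadicStep j (Int.fract x) + ⌊x⌋) :
    f ∈ thompsonT := by
  have hd : ∀ x, IsDyadic (G x) ↔ IsDyadic x := by
    intro x
    rw [hG, IsDyadic.add_iff_left (IsDyadic.intCast _), isDyadic_dyadicStep_iff, Int.fract,
      sub_eq_add_neg, IsDyadic.add_iff_left (IsDyadic.intCast _).neg]
  have hd' : ∀ θ, f θ ∈ dyadicPoints ↔ θ ∈ dyadicPoints := by
    intro θ
    obtain ⟨x, rfl⟩ := UnitAddCircle.coe_surjective θ
    rw [← hf.2, coe_mem_dyadicPoints, coe_mem_dyadicPoints, hd]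
  have hδ : IsDyadic (1 / 2 ^ (j + 1)) := ⟨1, j + 1, by norm_num⟩
  have h0 : (0 : ℝ) < 1 / 2 ^ (j + 1) := by positivity
  have h1 := one_div_two_pow_le_half j
  have hone : IsDyadic 1 := by exact_mod_cast IsDyadic.intCast 1
  set δ : ℝ := 1 / 2 ^ (j + 1) with hδ'
  refine ⟨?_, ((↑) : ℝ → UnitAddCircle) '' {0, 1 - 2 * δ, 1 - δ}, (Set.toFinite _).image _, ?_, ?_⟩
  · ext θ
    constructor
    · rintro ⟨η, hη, rfl⟩
      exact (hd' η).2 hη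
    · intro h
      refine ⟨f.symm θ, (hd' _).1 ?_, f.apply_symm_apply θ⟩
      rwa [f.apply_symm_apply]
  · rintro _ ⟨x, hx, rfl⟩
    rw [coe_mem_dyadicPoints]
    rcases hx with rfl | rfl | rfl
    · exact_mod_cast IsDyadic.intCast 0
    · rw [two_mul]
      exact hone.sub (hδ.add hδ)
    · exact hone.sub hδ
  · intro a b hab
    rcases le_or_gt b a with hba | hba
    · exact ⟨0, 0, fun x hx => absurd (hx.1.trans hx.2) (not_lt.2 hba)⟩
    have hav : ∀ (n : ℤ) (s : ℝ), s ∈ ({0, 1 - 2 * δ, 1 - δ} : Set ℝ) → s + n ∉ Set.Ioo a b :=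
      fun n s hs h => hab _ h ⟨s, hs, (UnitAddCircle.coe_add_int s n).symm⟩
    -- the interval lies between two consecutive integers `n` and `n + 1`
    set n := ⌊(a + b) / 2⌋ with hn
    have hn1 := Int.floor_le ((a + b) / 2)
    have hn2 := Int.lt_floor_add_one ((a + b) / 2)
    rw [← hn] at hn1 hn2
    have ha : (n : ℝ) ≤ a := by
      by_contra h
      exact hav n 0 (by simp) ⟨by linarith, by linarith⟩
    have hb : b ≤ n + 1 := by
      by_contra h
      exact hav (n + 1) 0 (by simp) ⟨by push_cast; linarith, by push_cast; linarith⟩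
    have hGx : ∀ x ∈ Set.Ioo a b, f x = ((dyadicStep j (x - n) + n : ℝ) : UnitAddCircle) := by
      intro x hx
      have hfl : ⌊x⌋ = n := Int.floor_eq_iff.2 ⟨by linarith [hx.1], by linarith [hx.2]⟩
      rw [← hf.2, hG, Int.fract, hfl]
    by_cases c1 : b ≤ 1 - 2 * δ + n
    · refine ⟨-1, 1 / 2 - n / 2 + n, fun x hx => ?_⟩
      rw [hGx x hx, dyadicStep_eq_left j (by linarith [hx.2])]
      congr 1
      norm_num
      ring
    have c1' : 1 - 2 * δ + n ≤ a := by
      by_contra h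
      exact hav n (1 - 2 * δ) (by simp) ⟨by linarith, by linarith⟩
    by_cases c2 : b ≤ 1 - δ + n
    · refine ⟨0, δ, fun x hx => ?_⟩
      rw [hGx x hx, dyadicStep_eq_middle j (by linarith [hx.1]) (by linarith [hx.2])]
      congr 1
      norm_num
      ring
    have c2' : 1 - δ + n ≤ a := by
      by_contra h
      exact hav n (1 - δ) (by simp) ⟨by linarith, by linarith⟩
    refine ⟨j, 2 ^ j * (-n - 1) + 3 / 2 + n, fun x hx => ?_⟩
    rw [hGx x hx, dyadicStep_eq_right j (by linarith [hx.1]), zpow_natCast]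
    congr 1
    ring

theorem translationNumber_of_dyadicStep {G : CircleDeg1Liftˣ}
    (hG : ∀ x, G x = dyadicStep j (Int.fract x) + ⌊x⌋) :
    CircleDeg1Lift.translationNumber (G : CircleDeg1Lift) = (1 : ℤ) / (j + 2 : ℕ) := by
  have hG' : ∀ x, 0 ≤ x → x < 1 → G x = dyadicStep j x := by
    intro x h0 h1
    rw [hG, Int.fract_eq_self.2 ⟨h0, h1⟩, Int.floor_eq_zero_iff.2 ⟨h0, h1⟩]
    simp
  have hpos : ∀ i : ℕ, (0 : ℝ) < 1 / 2 ^ i := fun i => by positivity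
  have hle : ∀ i : ℕ, (1 : ℝ) / 2 ^ i ≤ 1 := fun i =>
    (div_le_one (by positivity)).2 (one_le_pow₀ (by norm_num))
  have hit : ∀ i : ℕ, i ≤ j + 1 → ((G : CircleDeg1Lift) ^ i) 0 = 1 - 1 / 2 ^ i := by
    intro i hi
    induction i with
    | zero => simp
    | succ i ih =>
      rw [pow_succ', CircleDeg1Lift.mul_apply, ih (by omega), hG' _ (by linarith [hle i])
        (by linarith [hpos i]), dyadicStep_eq_left]
      · rw [pow_succ]; field_simp; ring
      · have h1 : (2 : ℝ) ^ i ≤ 2 ^ j := pow_le_pow_right₀ (by norm_num) (by omega)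
        have h2 : (1 : ℝ) / 2 ^ j ≤ 1 / 2 ^ i := one_div_le_one_div_of_le (by positivity) h1
        have h3 : 2 * ((1 : ℝ) / 2 ^ (j + 1)) = 1 / 2 ^ j := by rw [pow_succ]; field_simp
        linarith
  apply CircleDeg1Lift.translationNumber_of_map_pow_eq_add_int (x := 0) _ _ (by omega)
  rw [pow_succ', CircleDeg1Lift.mul_apply, hit _ le_rfl, hG' _ (by linarith [hle (j + 1)])
    (by linarith [hpos (j + 1)]), dyadicStep_eq_middle j (by linarith [hpos (j + 1)]) le_rfl]
  norm_num

end DyadicStep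

theorem exists_mem_thompsonT_hasRotationNumber (r : ℚ) :
    ∃ f ∈ thompsonT, HasRotationNumber f (((r : ℝ)) : UnitAddCircle) := by
  have hden := r.den_pos
  obtain ⟨G, hG⟩ := exists_unit_dyadicStep (2 * r.den - 2)
  obtain ⟨f, hf⟩ := exists_homeomorph_isCircleLift G
  have ht := translationNumber_of_dyadicStep _ hG
  obtain ⟨n, hn⟩ := exists_pow_hasRotationNumber hf (by omega) isCoprime_one_left ht (2 * r.num)
  refine ⟨f ^ n, pow_mem_thompsonT (mem_thompsonT_of_dyadicStep _ hf hG) n, ?_⟩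
  convert hn using 2
  rw [show 2 * r.den - 2 + 2 = 2 * r.den by omega]
  have : (r.den : ℝ) ≠ 0 := by positivity
  push_cast
  rw [mul_div_mul_left _ _ two_ne_zero]
  exact_mod_cast (Rat.num_div_den r).symm

/-! ### Polar coordinates in the plane -/

/-- The unit vector that spans `realRay t`. -/
noncomputable def unitVec (t : ℝ) : Fin 2 → ℝ :=
  ![Real.cos (2 * Real.pi * t), Real.sin (2 * Real.pi * t)]

/-- The linear identification of the plane with `ℂ`, through which the plane gets its Euclidean
norm `‖toComplex x‖`; the norm of `Fin 2 → ℝ` itself is the supremum norm. -/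
noncomputable def toComplex : (Fin 2 → ℝ) →L[ℝ] ℂ :=
  LinearMap.toContinuousLinearMap
    { toFun := fun x => ⟨x 0, x 1⟩
      map_add' := fun x y => by apply Complex.ext <;> simp
      map_smul' := fun a x => by apply Complex.ext <;> simp }

@[simp] theorem toComplex_re (x : Fin 2 → ℝ) : (toComplex x).re = x 0 := rfl

@[simp] theorem toComplex_im (x : Fin 2 → ℝ) : (toComplex x).im = x 1 := rfl

theorem toComplex_injective : Function.Injective toComplex := by
  intro x y h
  ext i
  fin_cases i
  · exact congrArg Complex.re h
  · exact congrArg Complex.im h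

theorem toComplex_unitVec (t : ℝ) :
    toComplex (unitVec t) = AddCircle.homeomorphCircle one_ne_zero (t : UnitAddCircle) := by
  rw [AddCircle.homeomorphCircle_apply, AddCircle.toCircle_apply_mk, Circle.coe_exp]
  apply Complex.ext
  · rw [Complex.exp_ofReal_mul_I_re]; simp [unitVec]
  · rw [Complex.exp_ofReal_mul_I_im]; simp [unitVec]

theorem norm_toComplex_unitVec (t : ℝ) : ‖toComplex (unitVec t)‖ = 1 := by
  rw [toComplex_unitVec, Circle.norm_coe]

theorem unitVec_eq_iff {s t : ℝ} :
    unitVec s = unitVec t ↔ (s : UnitAddCircle) = (t : UnitAddCircle) := by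
  rw [← toComplex_injective.eq_iff, toComplex_unitVec, toComplex_unitVec, Circle.coe_inj]
  exact (AddCircle.homeomorphCircle one_ne_zero).injective.eq_iff

theorem unitVec_ne_zero (t : ℝ) : unitVec t ≠ 0 := by
  intro h
  have := norm_toComplex_unitVec t
  rw [h] at this
  simp at this

theorem continuous_unitVec : Continuous unitVec := by
  refine continuous_pi fun i => ?_
  fin_cases i
  · exact Real.continuous_cos.comp (by fun_prop)
  · exact Real.continuous_sin.comp (by fun_prop)

theorem norm_toComplex_smul {r : ℝ} (hr : 0 ≤ r) (x : Fin 2 → ℝ) :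
    ‖toComplex (r • x)‖ = r * ‖toComplex x‖ := by
  rw [map_smul, norm_smul, Real.norm_of_nonneg hr]

theorem norm_toComplex_pos {x : Fin 2 → ℝ} (hx : x ≠ 0) : 0 < ‖toComplex x‖ :=
  norm_pos_iff.2 fun h => hx (toComplex_injective (by rw [h, map_zero]))

theorem exists_eq_smul_unitVec (x : Fin 2 → ℝ) : ∃ t : ℝ, x = ‖toComplex x‖ • unitVec t := by
  rcases eq_or_ne x 0 with rfl | hx
  · exact ⟨0, by simp⟩
  have hpos := norm_toComplex_pos hx
  have hz : toComplex x / ‖toComplex x‖ ∈ Submonoid.unitSphere ℂ := by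
    refine mem_sphere_zero_iff_norm.2 ?_
    rw [norm_div, Complex.norm_real, norm_norm, div_self hpos.ne']
  obtain ⟨θ, hθ⟩ := (AddCircle.homeomorphCircle (one_ne_zero (α := ℝ))).surjective
    (⟨_, hz⟩ : Circle)
  obtain ⟨t, rfl⟩ := UnitAddCircle.coe_surjective θ
  refine ⟨t, toComplex_injective ?_⟩
  rw [map_smul, toComplex_unitVec, hθ]
  change toComplex x = ‖toComplex x‖ • (toComplex x / ‖toComplex x‖)
  have : (‖toComplex x‖ : ℂ) ≠ 0 := by exact_mod_cast hpos.ne'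
  rw [Complex.real_smul]
  field_simp

theorem eq_of_smul_unitVec_eq {a b s t : ℝ} (ha : 0 < a) (hb : 0 < b)
    (h : a • unitVec s = b • unitVec t) : (s : UnitAddCircle) = (t : UnitAddCircle) := by
  have h1 : a = b := by
    have := congrArg (fun x => ‖toComplex x‖) h
    simpa only [norm_toComplex_smul ha.le, norm_toComplex_smul hb.le, norm_toComplex_unitVec,
      mul_one] using this
  rw [h1] at h
  exact unitVec_eq_iff.1 (smul_right_injective _ hb.ne' h)

/-- The determinant of two vectors of the plane. -/
def planeDet (x y : Fin 2 → ℝ) : ℝ := x 0 * y 1 - x 1 * y 0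

theorem planeDet_unitVec (s t : ℝ) :
    planeDet (unitVec s) (unitVec t) = Real.sin (2 * Real.pi * (t - s)) := by
  rw [mul_sub, Real.sin_sub]
  simp only [planeDet, unitVec, Matrix.cons_val_zero, Matrix.cons_val_one]
  ring

theorem planeDet_mulVec (L : Matrix (Fin 2) (Fin 2) ℝ) (x y : Fin 2 → ℝ) :
    planeDet (L *ᵥ x) (L *ᵥ y) = L.det * planeDet x y := by
  simp only [planeDet, Matrix.mulVec, dotProduct, Fin.sum_univ_two, Matrix.det_fin_two]
  ring

theorem planeDet_smul_smul (a b : ℝ) (x y : Fin 2 → ℝ) :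
    planeDet (a • x) (b • y) = a * b * planeDet x y := by
  simp only [planeDet, Pi.smul_apply, smul_eq_mul]
  ring

/-- A vector in terms of a basis, by Cramer's rule. -/
theorem eq_planeDet_smul_add {v w : Fin 2 → ℝ} (h : planeDet v w ≠ 0) (x : Fin 2 → ℝ) :
    x = (planeDet x w / planeDet v w) • v + (planeDet v x / planeDet v w) • w := by
  ext i
  simp only [Pi.add_apply, Pi.smul_apply, smul_eq_mul]
  rw [div_mul_eq_mul_div, div_mul_eq_mul_div, ← add_div, eq_div_iff h]
  fin_cases i <;> simp only [planeDet, Fin.zero_eta, Fin.mk_one] <;> ring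

theorem mem_closedCone_iff {v w : Fin 2 → ℝ} (h : 0 < planeDet v w) {x : Fin 2 → ℝ} :
    x ∈ closedCone v w ↔ 0 ≤ planeDet x w ∧ 0 ≤ planeDet v x := by
  constructor
  · rintro ⟨a, b, ha, hb, rfl⟩
    have e1 : planeDet (a • v + b • w) w = a * planeDet v w := by
      simp only [planeDet, Pi.add_apply, Pi.smul_apply, smul_eq_mul]; ring
    have e2 : planeDet v (a • v + b • w) = b * planeDet v w := by
      simp only [planeDet, Pi.add_apply, Pi.smul_apply, smul_eq_mul]; ring
    rw [e1, e2]
    exact ⟨by positivity, by positivity⟩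
  · rintro ⟨h1, h2⟩
    exact ⟨_, _, by positivity, by positivity, eq_planeDet_smul_add h.ne' x⟩

theorem isClosed_closedCone {v w : Fin 2 → ℝ} (h : 0 < planeDet v w) :
    IsClosed (closedCone v w) := by
  have : closedCone v w = {x | 0 ≤ planeDet x w} ∩ {x | 0 ≤ planeDet v x} :=
    Set.ext fun x => mem_closedCone_iff h
  rw [this]
  unfold planeDet
  exact (isClosed_le (by fun_prop) (by fun_prop)).inter (isClosed_le (by fun_prop) (by fun_prop))

theorem smul_mem_closedCone {v w x : Fin 2 → ℝ} {r : ℝ} (hr : 0 ≤ r) (hx : x ∈ closedCone v w) :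
    r • x ∈ closedCone v w := by
  obtain ⟨a, b, ha, hb, rfl⟩ := hx
  exact ⟨r * a, r * b, by positivity, by positivity, by rw [smul_add, smul_smul, smul_smul]⟩

theorem CompleteFan.planeDet_pos (Δ : CompleteFan) (i : Fin (Δ.d + 1)) :
    0 < planeDet (latticePoint (Δ.gen i)) (latticePoint (Δ.gen (i + 1))) := by
  have := Δ.counterclockwise i
  simp only [planeDet, latticePoint]
  exact_mod_cast this

theorem CompleteFan.exists_mem_sector (Δ : CompleteFan) (x : Fin 2 → ℝ) : ∃ i, x ∈ Δ.sector i := by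
  have : x ∈ ⋃ i, closedCone (latticePoint (Δ.gen i)) (latticePoint (Δ.gen (i + 1))) := by
    rw [Δ.complete]; trivial
  exact Set.mem_iUnion.1 this

/-! ### The action on rays of a positively homogeneous homeomorphism -/

/-- Positive homogeneity of a map of the plane. -/
def IsPosHomogeneous (F : (Fin 2 → ℝ) → (Fin 2 → ℝ)) : Prop :=
  ∀ r : ℝ, 0 ≤ r → ∀ x, F (r • x) = r • F x

namespace IsPosHomogeneous

variable {F : (Fin 2 → ℝ) ≃ₜ (Fin 2 → ℝ)}

theorem map_zero (hF : IsPosHomogeneous F) : F 0 = 0 := by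
  simpa using hF 0 le_rfl 0

theorem ne_zero (hF : IsPosHomogeneous F) {x : Fin 2 → ℝ} (hx : x ≠ 0) : F x ≠ 0 := by
  rw [← hF.map_zero]
  exact F.injective.ne hx

theorem symm (hF : IsPosHomogeneous F) : IsPosHomogeneous F.symm := by
  intro r hr x
  apply F.injective
  rw [F.apply_symm_apply, hF r hr, F.apply_symm_apply]

theorem exists_continuous_circle_map (hF : IsPosHomogeneous F) :
    ∃ φ : UnitAddCircle → UnitAddCircle, Continuous φ ∧ ∀ s t : ℝ,
      φ (s : UnitAddCircle) = (t : UnitAddCircle) →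
        F (unitVec s) = ‖toComplex (F (unitVec s))‖ • unitVec t := by
  set h := AddCircle.homeomorphCircle (one_ne_zero (α := ℝ)) with hh
  let e : UnitAddCircle → (Fin 2 → ℝ) := fun θ => ![(h θ : ℂ).re, (h θ : ℂ).im]
  have hc : Continuous fun θ => ((h θ : Circle) : ℂ) := continuous_subtype_val.comp h.continuous
  have he : Continuous e := by
    refine continuous_pi fun i => ?_
    fin_cases i
    · exact Complex.continuous_re.comp hc
    · exact Complex.continuous_im.comp hc
  have het : ∀ t : ℝ, e (t : UnitAddCircle) = unitVec t := by
    intro t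
    apply toComplex_injective
    rw [toComplex_unitVec]
    apply Complex.ext <;> simp [e, h]
  have hpos : ∀ θ, 0 < ‖toComplex (F (e θ))‖ := by
    intro θ
    obtain ⟨t, rfl⟩ := UnitAddCircle.coe_surjective θ
    rw [het]
    exact norm_toComplex_pos (hF.ne_zero (unitVec_ne_zero t))
  have hmem : ∀ θ, toComplex (F (e θ)) / ‖toComplex (F (e θ))‖ ∈ Submonoid.unitSphere ℂ := by
    intro θ
    refine mem_sphere_zero_iff_norm.2 ?_
    rw [norm_div, Complex.norm_real, norm_norm, div_self (hpos θ).ne']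
  let N : UnitAddCircle → Circle := fun θ => ⟨_, hmem θ⟩
  have hN : Continuous N := by
    refine Continuous.subtype_mk ?_ hmem
    have h1 : Continuous fun θ => toComplex (F (e θ)) :=
      toComplex.continuous.comp (F.continuous.comp he)
    exact h1.div (Complex.continuous_ofReal.comp h1.norm)
      fun θ => by exact_mod_cast (hpos θ).ne'
  refine ⟨h.symm ∘ N, h.symm.continuous.comp hN, fun s t hst => toComplex_injective ?_⟩
  have h1 : N (s : UnitAddCircle) = h (t : UnitAddCircle) := by
    rw [← hst]; exact (h.apply_symm_apply _).symm
  have hp := hpos (s : UnitAddCircle)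
  have h2 : (N (s : UnitAddCircle) : ℂ) =
    toComplex (F (e (s : UnitAddCircle))) / ‖toComplex (F (e (s : UnitAddCircle)))‖ := rfl
  rw [het] at h2 hp
  rw [map_smul, toComplex_unitVec t, ← hh, ← h1, h2, Complex.real_smul]
  have : (‖toComplex (F (unitVec s))‖ : ℂ) ≠ 0 := by exact_mod_cast hp.ne'
  field_simp

theorem exists_circle_homeomorph (hF : IsPosHomogeneous F) :
    ∃ f : UnitAddCircle ≃ₜ UnitAddCircle, ∀ s t : ℝ,
      f (s : UnitAddCircle) = (t : UnitAddCircle) →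
        F (unitVec s) = ‖toComplex (F (unitVec s))‖ • unitVec t := by
  obtain ⟨φ, hφ, hφ'⟩ := hF.exists_continuous_circle_map
  obtain ⟨χ, hχ, hχ'⟩ := hF.symm.exists_continuous_circle_map
  refine ⟨⟨⟨φ, χ, fun θ => ?_, fun θ => ?_⟩, hφ, hχ⟩, hφ'⟩
  · obtain ⟨s, rfl⟩ := UnitAddCircle.coe_surjective θ
    obtain ⟨t, ht⟩ := UnitAddCircle.coe_surjective (φ s)
    obtain ⟨u, hu⟩ := UnitAddCircle.coe_surjective (χ t)
    rw [← ht, ← hu]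
    have h1 := hφ' s t ht.symm
    have h2 := hχ' t u hu.symm
    have p1 := norm_toComplex_pos (hF.ne_zero (unitVec_ne_zero s))
    have p2 := norm_toComplex_pos (hF.symm.ne_zero (unitVec_ne_zero t))
    refine eq_of_smul_unitVec_eq (mul_pos p1 p2) one_pos ?_
    rw [one_smul, mul_smul, ← h2, ← hF.symm _ p1.le, ← h1, F.symm_apply_apply]
  · obtain ⟨s, rfl⟩ := UnitAddCircle.coe_surjective θ
    obtain ⟨t, ht⟩ := UnitAddCircle.coe_surjective (χ s)
    obtain ⟨u, hu⟩ := UnitAddCircle.coe_surjective (φ t)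
    rw [← ht, ← hu]
    have h1 := hχ' s t ht.symm
    have h2 := hφ' t u hu.symm
    have p1 := norm_toComplex_pos (hF.symm.ne_zero (unitVec_ne_zero s))
    have p2 := norm_toComplex_pos (hF.ne_zero (unitVec_ne_zero t))
    refine eq_of_smul_unitVec_eq (mul_pos p1 p2) one_pos ?_
    rw [one_smul, mul_smul, ← h2, ← hF _ p1.le, ← h1, F.apply_symm_apply]

end IsPosHomogeneous

/-- `G` is a lift to `ℝ` of the action on rays of the positively homogeneous map `F`. -/
structure IsRayLift (F : (Fin 2 → ℝ) ≃ₜ (Fin 2 → ℝ)) (G : CircleDeg1Liftˣ) : Prop where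
  homogeneous : IsPosHomogeneous F
  map_unitVec : ∀ t, F (unitVec t) = ‖toComplex (F (unitVec t))‖ • unitVec (G t)

namespace IsRayLift

variable {F F' : (Fin 2 → ℝ) ≃ₜ (Fin 2 → ℝ)} {G G' : CircleDeg1Liftˣ}

theorem map_smul_unitVec (h : IsRayLift F G) {r : ℝ} (hr : 0 ≤ r) (t : ℝ) :
    F (r • unitVec t) = ‖toComplex (F (r • unitVec t))‖ • unitVec (G t) := by
  rw [h.homogeneous r hr, norm_toComplex_smul hr, mul_smul, ← h.map_unitVec]

theorem one : IsRayLift 1 1 :=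
  ⟨fun _ _ _ => rfl, fun t => by
    change unitVec t = ‖toComplex (unitVec t)‖ • unitVec t
    rw [norm_toComplex_unitVec, one_smul]⟩

theorem mul (h : IsRayLift F G) (h' : IsRayLift F' G') : IsRayLift (F * F') (G * G') where
  homogeneous r hr x := by
    change F (F' _) = r • F (F' _)
    rw [h'.homogeneous r hr, h.homogeneous r hr]
  map_unitVec t := by
    change F (F' _) = ‖toComplex (F (F' _))‖ • _
    rw [Units.val_mul, CircleDeg1Lift.mul_apply, h'.map_unitVec t]
    exact h.map_smul_unitVec (norm_nonneg _) _

theorem inv (h : IsRayLift F G) : IsRayLift F⁻¹ G⁻¹ where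
  homogeneous := h.homogeneous.symm
  map_unitVec t := by
    have h1 := h.map_unitVec ((G⁻¹ : CircleDeg1Liftˣ) t)
    rw [CircleDeg1Lift.units_apply_inv_apply] at h1
    set s := (G⁻¹ : CircleDeg1Liftˣ) t
    set a := ‖toComplex (F (unitVec s))‖ with ha
    have ha0 : 0 < a := norm_toComplex_pos (h.homogeneous.ne_zero (unitVec_ne_zero s))
    have h2 : unitVec t = F (a⁻¹ • unitVec s) := by
      rw [h.homogeneous _ (inv_nonneg.2 ha0.le), h1, smul_smul, inv_mul_cancel₀ ha0.ne', one_smul]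
    rw [Homeomorph.inv_apply, h2, F.symm_apply_apply, norm_toComplex_smul (inv_nonneg.2 ha0.le),
      norm_toComplex_unitVec, mul_one]

theorem zpow (h : IsRayLift F G) (i : ℤ) : IsRayLift (F ^ i) (G ^ i) := by
  induction i using Int.induction_on with
  | zero => exact one
  | succ i ih => rw [zpow_add_one, zpow_add_one]; exact ih.mul h
  | pred i ih => rw [zpow_sub_one, zpow_sub_one]; exact ih.mul h.inv

theorem pow (h : IsRayLift F G) (n : ℕ) : IsRayLift (F ^ n) (G ^ n) := by
  simpa using h.zpow n

theorem inducesOnRays (h : IsRayLift F G) {f : UnitAddCircle ≃ₜ UnitAddCircle}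
    (hf : IsCircleLift f G) : InducesOnRays F f := by
  intro s t hst
  have hu : unitVec (G s) = unitVec t := unitVec_eq_iff.2 ((hf.2 s).trans hst)
  have h1 := h.map_unitVec s
  rw [hu] at h1
  set a := ‖toComplex (F (unitVec s))‖
  have ha0 : 0 < a := norm_toComplex_pos (h.homogeneous.ne_zero (unitVec_ne_zero s))
  ext y
  constructor
  · rintro ⟨_, ⟨r, hr, rfl⟩, rfl⟩
    refine ⟨r * a, by positivity, ?_⟩
    change F (r • unitVec s) = (r * a) • unitVec t
    rw [h.homogeneous r hr, h1, smul_smul]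
  · rintro ⟨r, hr, rfl⟩
    refine ⟨(r / a) • unitVec s, ⟨r / a, by positivity, rfl⟩, ?_⟩
    change _ = r • unitVec t
    rw [h.homogeneous _ (by positivity), h1, smul_smul, div_mul_cancel₀ _ ha0.ne']

end IsRayLift

/-! ### Piecewise linear automorphisms have rational rotation number -/

theorem isPosHomogeneous_of_linear_on_sectors {F : (Fin 2 → ℝ) ≃ₜ (Fin 2 → ℝ)} {Δ : CompleteFan}
    {L : Fin (Δ.d + 1) → Matrix (Fin 2) (Fin 2) ℝ} (hL : ∀ i, ∀ x ∈ Δ.sector i, F x = L i *ᵥ x) :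
    IsPosHomogeneous F := by
  intro r hr x
  obtain ⟨i, hi⟩ := Δ.exists_mem_sector x
  rw [hL i x hi, hL i _ (smul_mem_closedCone hr hi), Matrix.mulVec_smul]

/-- Just after the direction of its first generator, a cone contains all directions. -/
theorem eventually_unitVec_mem_closedCone {v w : Fin 2 → ℝ} (h : 0 < planeDet v w) {r s : ℝ}
    (hr : 0 < r) (hv : v = r • unitVec s) :
    ∀ᶠ t in 𝓝[>] s, unitVec t ∈ closedCone v w := by
  have h1 : 0 < planeDet (unitVec s) w := by
    rw [hv, ← one_smul ℝ w, planeDet_smul_smul, mul_one] at h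
    exact pos_of_mul_pos_right h hr.le
  have hc : Continuous fun t => planeDet (unitVec t) w := by
    have := continuous_unitVec
    unfold planeDet
    fun_prop
  have h2 : ∀ᶠ t in 𝓝[>] s, 0 < planeDet (unitVec t) w :=
    nhdsWithin_le_nhds (hc.continuousAt.eventually (eventually_gt_nhds h1))
  filter_upwards [h2, Ioo_mem_nhdsGT (show s < s + 1 / 2 by linarith)] with t ht hts
  refine (mem_closedCone_iff h).2 ⟨ht.le, ?_⟩
  rw [hv, ← one_smul ℝ (unitVec t), planeDet_smul_smul, planeDet_unitVec]
  have hpi := Real.pi_pos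
  have := Real.sin_pos_of_pos_of_lt_pi (x := 2 * Real.pi * (t - s))
    (mul_pos (by positivity) (by linarith [hts.1])) (by nlinarith [hts.2])
  positivity

/-- A piecewise linear automorphism acts on the circle of rays by an orientation preserving
homeomorphism. -/
theorem exists_isRayLift {F : (Fin 2 → ℝ) ≃ₜ (Fin 2 → ℝ)} (hF : F ∈ plAutomorphisms) :
    ∃ (f : UnitAddCircle ≃ₜ UnitAddCircle) (G : CircleDeg1Liftˣ), IsCircleLift f G ∧
      IsRayLift F G := by
  obtain ⟨⟨Δ, L, hL⟩, -⟩ := hF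
  have hhom := isPosHomogeneous_of_linear_on_sectors fun i => (hL i).2
  obtain ⟨f, hf⟩ := hhom.exists_circle_homeomorph
  obtain ⟨g, hg⟩ := exists_isCircleLift f
  have hFg : ∀ t, F (unitVec t) = ‖toComplex (F (unitVec t))‖ • unitVec (g t) :=
    fun t => hf t (g t) (hg.2 t).symm
  suffices StrictMono g by
    obtain ⟨G, hG⟩ := hg.exists_unit this
    have e : ⇑(G : CircleDeg1Lift) = g := funext hG
    exact ⟨f, G, e ▸ hg, hhom, fun t => by rw [hG]; exact hFg t⟩
  -- on the first sector `F` is linear with positive determinant, so `g` cannot be decreasing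
  refine hg.strictMono_or_strictAnti.resolve_right fun hanti => ?_
  have hdet := Δ.planeDet_pos 0
  set v := latticePoint (Δ.gen 0)
  set w := latticePoint (Δ.gen (0 + 1))
  have hv0 : v ≠ 0 := by
    intro h
    rw [h] at hdet
    simp [planeDet] at hdet
  obtain ⟨s, hs⟩ := exists_eq_smul_unitVec v
  have hr := norm_toComplex_pos hv0
  have hs_mem : unitVec s ∈ closedCone v w := by
    have : v ∈ closedCone v w := ⟨1, 0, zero_le_one, le_rfl, by simp⟩
    have h := smul_mem_closedCone (inv_nonneg.2 hr.le) this
    rwa [hs, smul_smul, norm_toComplex_smul hr.le, norm_toComplex_unitVec, mul_one,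
      inv_mul_cancel₀ hr.ne', one_smul, ← hs] at h
  have h1 := eventually_unitVec_mem_closedCone hdet hr hs
  have h2 : ∀ᶠ t in 𝓝[>] s, g s - 1 / 2 < g t :=
    nhdsWithin_le_nhds (hg.1.continuousAt.eventually (eventually_gt_nhds (by linarith)))
  obtain ⟨t, ⟨ht1, ht2⟩, ht3⟩ :=
    ((h1.and h2).and (Ioo_mem_nhdsGT (show s < s + 1 / 2 by linarith))).exists
  have e1 := planeDet_mulVec (L 0) (unitVec s) (unitVec t)
  rw [← (hL 0).2 _ hs_mem, ← (hL 0).2 _ ht1, hFg s, hFg t, planeDet_smul_smul, planeDet_unitVec,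
    planeDet_unitVec] at e1
  have hpi := Real.pi_pos
  have p1 := Real.sin_pos_of_pos_of_lt_pi (x := 2 * Real.pi * (t - s))
    (mul_pos (by positivity) (by linarith [ht3.1])) (by nlinarith [ht3.2])
  have hgt := hanti ht3.1
  have p2 := Real.sin_neg_of_neg_of_neg_pi_lt (x := 2 * Real.pi * (g t - g s))
    (mul_neg_of_pos_of_neg (by positivity) (by linarith)) (by nlinarith)
  have q1 := norm_toComplex_pos (hhom.ne_zero (unitVec_ne_zero s))
  have q2 := norm_toComplex_pos (hhom.ne_zero (unitVec_ne_zero t))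
  have := mul_pos (hL 0).1 p1
  rw [← e1] at this
  exact absurd this (not_lt.2 (mul_nonpos_of_nonneg_of_nonpos (by positivity) p2.le))

/-- A function that is `K`-Lipschitz on each of finitely many closed sets that cover an interval is
`K`-Lipschitz between the end points, even when the sets are not intervals. The proof removes one
set at a time: follow the set that contains the left end point up to its last point. -/
theorem abs_sub_le_of_closed_cover {ι : Type*} [DecidableEq ι] {ψ : ℝ → ℝ} {K : ℝ}
    {A : ι → Set ℝ} (hA : ∀ i, IsClosed (A i))
    (hψ : ∀ i, ∀ x ∈ A i, ∀ y ∈ A i, |ψ y - ψ x| ≤ K * |y - x|) (s : Finset ι) {a b : ℝ}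
    (hab : a ≤ b) (hcov : Set.Icc a b ⊆ ⋃ i ∈ s, A i) : |ψ b - ψ a| ≤ K * (b - a) := by
  induction s using Finset.strongInduction generalizing a with
  | H s ih =>
    obtain ⟨i, his, hai⟩ := Set.mem_iUnion₂.1 (hcov (Set.left_mem_Icc.2 hab))
    have hcpt : IsCompact (Set.Icc a b ∩ A i) := isCompact_Icc.inter_right (hA i)
    obtain ⟨t, ⟨hab', ht⟩, hmax⟩ := hcpt.exists_isGreatest ⟨a, Set.left_mem_Icc.2 hab, hai⟩
    have h1 := hψ i a hai t ht
    rw [abs_of_nonneg (sub_nonneg.2 hab'.1)] at h1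
    rcases hab'.2.eq_or_lt with rfl | htb
    · exact h1
    have h2 : Set.Icc t b ⊆ ⋃ j ∈ s.erase i, A j := by
      rw [← closure_Ioc htb.ne]
      refine closure_minimal (fun x hx => ?_)
        ((s.erase i).finite_toSet.isClosed_biUnion fun j _ => hA j)
      have hxab : x ∈ Set.Icc a b := ⟨hab'.1.trans hx.1.le, hx.2⟩
      obtain ⟨j, hj, hxj⟩ := Set.mem_iUnion₂.1 (hcov hxab)
      refine Set.mem_iUnion₂.2 ⟨j, Finset.mem_erase.2 ⟨?_, hj⟩, hxj⟩
      rintro rfl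
      exact absurd (hmax ⟨hxab, hxj⟩) (not_le.2 hx.1)
    have h3 := ih _ (Finset.erase_ssubset his) htb.le h2
    calc |ψ b - ψ a| ≤ |ψ b - ψ t| + |ψ t - ψ a| := abs_sub_le _ _ _
      _ ≤ K * (b - t) + K * (t - a) := add_le_add h3 h1
      _ = K * (b - a) := by ring

theorem norm_toComplex_unitVec_sub_le (s t : ℝ) :
    ‖toComplex (unitVec t - unitVec s)‖ ≤ 4 * Real.pi * |t - s| := by
  have h0 : |2 * Real.pi * t - 2 * Real.pi * s| = 2 * Real.pi * |t - s| := by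
    rw [← mul_sub, abs_mul, abs_of_pos (by positivity)]
  have h1 : |Real.cos (2 * Real.pi * t) - Real.cos (2 * Real.pi * s)| ≤ 2 * Real.pi * |t - s| := by
    simpa [Real.dist_eq, h0] using
      Real.lipschitzWith_cos.dist_le_mul (2 * Real.pi * t) (2 * Real.pi * s)
  have h2 : |Real.sin (2 * Real.pi * t) - Real.sin (2 * Real.pi * s)| ≤ 2 * Real.pi * |t - s| := by
    simpa [Real.dist_eq, h0] using
      Real.lipschitzWith_sin.dist_le_mul (2 * Real.pi * t) (2 * Real.pi * s)
  refine (Complex.norm_le_abs_re_add_abs_im _).trans ?_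
  simp only [toComplex_re, toComplex_im, Pi.sub_apply, unitVec, Matrix.cons_val_zero,
    Matrix.cons_val_one]
  linarith

theorem exists_norm_toComplex_mulVec_le (L : Matrix (Fin 2) (Fin 2) ℝ) :
    ∃ C : ℝ, 0 ≤ C ∧ ∀ x, ‖toComplex (L *ᵥ x)‖ ≤ C * ‖toComplex x‖ := by
  refine ⟨|L 0 0| + |L 0 1| + |L 1 0| + |L 1 1|, by positivity, fun x => ?_⟩
  refine (Complex.norm_le_abs_re_add_abs_im _).trans ?_
  have h0 : |x 0| ≤ ‖toComplex x‖ := Complex.abs_re_le_norm (toComplex x)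
  have h1 : |x 1| ≤ ‖toComplex x‖ := Complex.abs_im_le_norm (toComplex x)
  simp only [toComplex_re, toComplex_im, Matrix.mulVec, dotProduct, Fin.sum_univ_two]
  have a1 := abs_add_le (L 0 0 * x 0) (L 0 1 * x 1)
  have a2 := abs_add_le (L 1 0 * x 0) (L 1 1 * x 1)
  simp only [abs_mul] at a1 a2
  have b1 := mul_le_mul_of_nonneg_left h0 (abs_nonneg (L 0 0))
  have b2 := mul_le_mul_of_nonneg_left h1 (abs_nonneg (L 0 1))
  have b3 := mul_le_mul_of_nonneg_left h0 (abs_nonneg (L 1 0))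
  have b4 := mul_le_mul_of_nonneg_left h1 (abs_nonneg (L 1 1))
  linarith

/-- The logarithm of the factor by which `F` stretches the unit vector in direction `t`. For an
area preserving `F`, minus twice this number is the logarithm of the derivative of the action on
directions. -/
noncomputable def logStretch (F : (Fin 2 → ℝ) → (Fin 2 → ℝ)) (t : ℝ) : ℝ :=
  Real.log ‖toComplex (F (unitVec t))‖

theorem abs_log_sub_log_le {m x y : ℝ} (hm : 0 < m) (hx : m ≤ x) (hy : m ≤ y) :
    |Real.log y - Real.log x| ≤ |y - x| / m := by
  wlog h : x ≤ y generalizing x y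
  · rw [abs_sub_comm, abs_sub_comm y]
    exact this hy hx (le_of_not_ge h)
  have hx0 := hm.trans_le hx
  have hy0 := hm.trans_le hy
  rw [abs_of_nonneg (sub_nonneg.2 (Real.log_le_log hx0 h)), abs_of_nonneg (sub_nonneg.2 h),
    ← Real.log_div hy0.ne' hx0.ne']
  have h1 := Real.log_le_sub_one_of_pos (div_pos hy0 hx0)
  have h2 : y / x - 1 = (y - x) / x := by field_simp
  rw [h2] at h1
  exact h1.trans (div_le_div_of_nonneg_left (sub_nonneg.2 h) hm hx)

/-- The logarithm of the stretching factor is Lipschitz, since it is so on the arc of directions of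
each sector. -/
theorem exists_abs_logStretch_sub_le {F : (Fin 2 → ℝ) ≃ₜ (Fin 2 → ℝ)} {Δ : CompleteFan}
    {L : Fin (Δ.d + 1) → Matrix (Fin 2) (Fin 2) ℝ} (hL : ∀ i, ∀ x ∈ Δ.sector i, F x = L i *ᵥ x) :
    ∃ K : ℝ, 0 ≤ K ∧ ∀ a b : ℝ, a ≤ b → |logStretch F b - logStretch F a| ≤ K * (b - a) := by
  have hhom := isPosHomogeneous_of_linear_on_sectors hL
  -- a positive lower bound for the stretching factors, by compactness
  obtain ⟨m, hm, hm'⟩ : ∃ m : ℝ, 0 < m ∧ ∀ t, m ≤ ‖toComplex (F (unitVec t))‖ := by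
    have hc : Continuous fun t => ‖toComplex (F (unitVec t))‖ :=
      (toComplex.continuous.comp (F.continuous.comp continuous_unitVec)).norm
    obtain ⟨t₀, -, ht₀⟩ := (isCompact_Icc (a := (0 : ℝ)) (b := 1)).exists_isMinOn
      (Set.nonempty_Icc.2 zero_le_one) hc.continuousOn
    refine ⟨_, norm_toComplex_pos (hhom.ne_zero (unitVec_ne_zero t₀)), fun t => ?_⟩
    have h := ht₀ ⟨Int.fract_nonneg t, (Int.fract_lt_one t).le⟩
    have e : unitVec (Int.fract t) = unitVec t :=
      unitVec_eq_iff.2 (by rw [← UnitAddCircle.coe_add_int _ ⌊t⌋, Int.fract_add_floor])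
    change _ ≤ ‖toComplex (F (unitVec (Int.fract t)))‖ at h
    rwa [e] at h
  choose C hC hC' using fun i => exists_norm_toComplex_mulVec_le (L i)
  set S := ∑ i, C i with hS
  have hS0 : 0 ≤ S := Finset.sum_nonneg fun i _ => hC i
  have hCS : ∀ i, C i ≤ S := fun i => Finset.single_le_sum (fun j _ => hC j) (Finset.mem_univ i)
  have hpi := Real.pi_pos
  refine ⟨S * (4 * Real.pi) / m, by positivity, fun a b hab => ?_⟩
  refine abs_sub_le_of_closed_cover (A := fun i => unitVec ⁻¹' Δ.sector i)
    (fun i => (isClosed_closedCone (Δ.planeDet_pos i)).preimage continuous_unitVec) ?_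
    Finset.univ hab ?_
  · intro i x hx y hy
    refine (abs_log_sub_log_le hm (hm' x) (hm' y)).trans ?_
    rw [div_mul_eq_mul_div]
    refine div_le_div_of_nonneg_right ?_ hm.le
    refine (abs_norm_sub_norm_le _ _).trans ?_
    rw [← map_sub, hL i _ hx, hL i _ hy, ← Matrix.mulVec_sub]
    calc _ ≤ C i * ‖toComplex (unitVec y - unitVec x)‖ := hC' i _
      _ ≤ S * (4 * Real.pi * |y - x|) :=
        mul_le_mul (hCS i) (norm_toComplex_unitVec_sub_le x y) (norm_nonneg _) hS0
      _ = S * (4 * Real.pi) * |y - x| := by ring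
  · intro x _
    obtain ⟨i, hi⟩ := Δ.exists_mem_sector (unitVec x)
    exact Set.mem_iUnion₂.2 ⟨i, Finset.mem_univ i, hi⟩

open MeasureTheory in
theorem sub_le_volume_real_coe_image_Ioo {a b : ℝ} (hab : a < b) (hba : b < a + 1) :
    b - a ≤ (volume : Measure UnitAddCircle).real (((↑) : ℝ → UnitAddCircle) '' Set.Ioo a b) := by
  have hm : MeasurableSet (((↑) : ℝ → UnitAddCircle) '' Set.Ioo a b) :=
    (QuotientAddGroup.isOpenMap_coe _ isOpen_Ioo).measurableSet
  rw [measureReal_def, ← (UnitAddCircle.measurePreserving_mk a).measure_preimage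
    hm.nullMeasurableSet, ← measureReal_def]
  have h1 : (volume.restrict (Set.Ioc a (a + 1))).real (Set.Ioo a b) = b - a := by
    rw [measureReal_restrict_apply measurableSet_Ioo, Set.inter_eq_left.2
      (Set.Ioo_subset_Ioc_self.trans (Set.Ioc_subset_Ioc_right hba.le)),
      Real.volume_real_Ioo_of_le hab.le]
  rw [← h1]
  exact measureReal_mono (Set.subset_preimage_image _ _)

theorem finite_integerLattice_norm_le (R : ℝ) :
    {x ∈ integerLattice | ‖toComplex x‖ ≤ R}.Finite := by
  refine ((Set.finite_Icc (fun _ : Fin 2 => -⌈R⌉) (fun _ => ⌈R⌉)).image latticePoint).subset ?_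
  rintro _ ⟨⟨v, rfl⟩, hv⟩
  refine ⟨v, ?_, rfl⟩
  have h : ∀ i, |v i| ≤ ⌈R⌉ := by
    intro i
    have : |(v i : ℝ)| ≤ R := by
      fin_cases i
      · exact (Complex.abs_re_le_norm (toComplex (latticePoint v))).trans hv
      · exact (Complex.abs_im_le_norm (toComplex (latticePoint v))).trans hv
    exact_mod_cast this.trans (Int.le_ceil R)
  exact ⟨fun i => (abs_le.1 (h i)).1, fun i => (abs_le.1 (h i)).2⟩

theorem zpow_mem_integerLattice {F : (Fin 2 → ℝ) ≃ₜ (Fin 2 → ℝ)}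
    (hF : F '' integerLattice = integerLattice) {x : Fin 2 → ℝ} (hx : x ∈ integerLattice) (i : ℤ) :
    (F ^ i) x ∈ integerLattice := by
  induction i using Int.induction_on with
  | zero => exact hx
  | succ i ih =>
    rw [add_comm, zpow_add, zpow_one]
    change F _ ∈ _
    rw [← hF]
    exact ⟨_, ih, rfl⟩
  | pred i ih =>
    rw [sub_eq_neg_add, zpow_add, zpow_neg_one]
    change F.symm ((F ^ (-(i : ℤ))) x) ∈ _
    rw [← hF] at ih
    obtain ⟨y, hy, hy'⟩ := ih
    rwa [← hy', F.symm_apply_apply]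

/-- The rationality criterion applies to the orbit of the lattice vector `(1, 0)`, with the
logarithm of the length as height. -/
theorem exists_rat_of_mem_plAutomorphisms {F : (Fin 2 → ℝ) ≃ₜ (Fin 2 → ℝ)}
    (hF : F ∈ plAutomorphisms) : ∃ r : ℚ, HasRayRotationNumber F (((r : ℝ)) : UnitAddCircle) := by
  obtain ⟨f, G, hfG, hG⟩ := exists_isRayLift hF
  obtain ⟨⟨Δ, L, hL⟩, hlat⟩ := hF
  suffices ¬ Irrational (CircleDeg1Lift.translationNumber (G : CircleDeg1Lift)) by
    obtain ⟨r, hr⟩ := exists_rat_hasRotationNumber hfG this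
    exact ⟨r, f, hG.inducesOnRays hfG, hr⟩
  obtain ⟨K, hK, hLip⟩ := exists_abs_logStretch_sub_le fun i => (hL i).2
  -- `v` is the lattice vector `(1, 0)`, which spans the ray of direction `0`
  set v := unitVec 0 with hv
  have hvlat : v ∈ integerLattice := by
    refine ⟨![1, 0], ?_⟩
    ext i
    fin_cases i <;> simp [latticePoint, hv, unitVec]
  have horb : ∀ i : ℤ, (F ^ i) v = ‖toComplex ((F ^ i) v)‖ • unitVec ((G ^ i) 0) :=
    fun i => (hG.zpow i).map_unitVec 0
  have hpos : ∀ i : ℤ, 0 < ‖toComplex ((F ^ i) v)‖ := fun i =>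
    norm_toComplex_pos ((hG.zpow i).homogeneous.ne_zero (unitVec_ne_zero 0))
  refine CircleDeg1Lift.not_irrational_translationNumber G 0 (logStretch F) (fun y m => ?_)
    (K.toNNReal • MeasureTheory.volume) Set.univ (fun _ _ => trivial) ?_
    (fun i => Real.log ‖toComplex ((F ^ i) v)‖) fun hinj => ⟨?_, ?_⟩
  · rw [logStretch, logStretch, unitVec_eq_iff.2 (UnitAddCircle.coe_add_int y m)]
  · intro a _ b _ hab hba
    refine (hLip a b hab.le).trans ?_
    rw [MeasureTheory.measureReal_nnreal_smul_apply, Real.coe_toNNReal K hK]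
    exact mul_le_mul_of_nonneg_left (sub_le_volume_real_coe_image_Ioo hab hba) hK
  · refine tendsto_atTop.2 fun b => ?_
    have hinj' : Function.Injective fun i : ℤ => (F ^ i) v := by
      intro i j hij
      refine hinj (eq_of_smul_unitVec_eq (hpos i) (hpos j) ?_)
      rw [← horb, ← horb]
      exact hij
    refine (((finite_integerLattice_norm_le (Real.exp b)).preimage hinj'.injOn)).subset ?_
    intro i hi
    refine ⟨zpow_mem_integerLattice hlat hvlat i, ?_⟩
    change ¬ b ≤ _ at hi
    rw [not_le, Real.log_lt_iff_lt_exp (hpos i)] at hi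
    exact hi.le
  · convert Set.finite_empty
    ext i
    simp only [Set.mem_ofPred_eq, Set.mem_empty_iff_false, iff_false, not_not]
    have h1 : (F ^ (i + 1)) v = F ((F ^ i) v) := by
      rw [add_comm, zpow_add, zpow_one]; rfl
    have h2 : ‖toComplex ((F ^ (i + 1)) v)‖ =
        ‖toComplex ((F ^ i) v)‖ * ‖toComplex (F (unitVec ((G ^ i) 0)))‖ := by
      rw [h1]
      nth_rewrite 1 [horb i]
      rw [hG.homogeneous _ (hpos i).le, norm_toComplex_smul (hpos i).le]
    have h3 := norm_toComplex_pos (hG.homogeneous.ne_zero (unitVec_ne_zero ((G ^ i) 0)))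
    rw [h2, Real.log_mul (hpos i).ne' h3.ne', logStretch]
    ring

/-! ### Piecewise linear automorphisms with prescribed rotation number -/

section CyclicFan

variable (m : ℕ)

/-- The generators of a complete unimodular fan with `m + 3` rays: the vectors `(1, 0)`, `(1, 1)`,
..., `(1, m)`, then `(0, 1)` and `(-1, -1)`. -/
def fanGen (i : Fin (m + 3)) : Fin 2 → ℤ :=
  if (i : ℕ) ≤ m then ![1, (i : ℕ)] else if (i : ℕ) = m + 1 then ![0, 1] else ![-1, -1]

/-- The generators of the fan as real vectors. -/
def fanVec (i : Fin (m + 3)) : Fin 2 → ℝ := latticePoint (fanGen m i)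

/-- The number of the half-open sector, containing its first ray but not its second, in which `x`
lies. -/
noncomputable def sectorIndex (x : Fin 2 → ℝ) : ℕ :=
  if x 1 < 0 ∧ x 1 ≤ x 0 then m + 2 else if x 0 ≤ 0 ∧ x 0 < x 1 then m + 1 else
    min ⌊x 1 / x 0⌋₊ m

variable {m}

theorem fanGen_cases (i : Fin (m + 3)) :
    (∃ k : ℕ, k < m ∧ (i : ℕ) = k ∧ fanGen m i = ![1, (k : ℤ)] ∧
      fanGen m (i + 1) = ![1, (k : ℤ) + 1]) ∨
    ((i : ℕ) = m ∧ fanGen m i = ![1, (m : ℤ)] ∧ fanGen m (i + 1) = ![0, 1]) ∨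
    ((i : ℕ) = m + 1 ∧ fanGen m i = ![0, 1] ∧ fanGen m (i + 1) = ![-1, -1]) ∨
    ((i : ℕ) = m + 2 ∧ fanGen m i = ![-1, -1] ∧ fanGen m (i + 1) = ![1, 0]) := by
  have hi := i.isLt
  have hval : ((i + 1 : Fin (m + 3)) : ℕ) = if (i : ℕ) = m + 2 then 0 else (i : ℕ) + 1 := by
    rw [Fin.val_add_one]
    congr 1
    rw [Fin.ext_iff, Fin.val_last]
  rcases lt_trichotomy (i : ℕ) m with h | h | h
  · rw [if_neg (by omega)] at hval
    refine Or.inl ⟨i, h, rfl, ?_, ?_⟩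
    · rw [fanGen, if_pos h.le]
    · rw [fanGen, hval, if_pos (by omega)]
      push_cast
      rfl
  · rw [if_neg (by omega)] at hval
    refine Or.inr (Or.inl ⟨h, ?_, ?_⟩)
    · rw [fanGen, if_pos h.le, h]
    · rw [fanGen, hval, if_neg (by omega), if_pos (by omega)]
  rcases (show (i : ℕ) = m + 1 ∨ (i : ℕ) = m + 2 by omega) with h' | h'
  · rw [if_neg (by omega)] at hval
    refine Or.inr (Or.inr (Or.inl ⟨h', ?_, ?_⟩))
    · rw [fanGen, if_neg (by omega), if_pos h']
    · rw [fanGen, hval, if_neg (by omega), if_neg (by omega)]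
  · rw [if_pos h'] at hval
    refine Or.inr (Or.inr (Or.inr ⟨h', ?_, ?_⟩))
    · rw [fanGen, if_neg (by omega), if_neg (by omega)]
    · rw [fanGen, hval, if_pos (by omega)]
      rfl

theorem fanGen_unimodular (i : Fin (m + 3)) :
    fanGen m i 0 * fanGen m (i + 1) 1 - fanGen m i 1 * fanGen m (i + 1) 0 = 1 := by
  rcases fanGen_cases i with ⟨k, -, -, h, h'⟩ | ⟨-, h, h'⟩ | ⟨-, h, h'⟩ | ⟨-, h, h'⟩ <;>
    rw [h, h'] <;> simp

theorem planeDet_fanVec (i : Fin (m + 3)) : planeDet (fanVec m i) (fanVec m (i + 1)) = 1 := by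
  have := fanGen_unimodular i
  simp only [planeDet, fanVec, latticePoint]
  exact_mod_cast this

theorem sectorIndex_eq (i : Fin (m + 3)) {a b : ℝ} (ha : 0 < a) (hb : 0 ≤ b) :
    sectorIndex m (a • fanVec m i + b • fanVec m (i + 1)) = i := by
  unfold sectorIndex fanVec latticePoint
  rcases fanGen_cases i with ⟨k, hk, hi, h, h'⟩ | ⟨hi, h, h'⟩ | ⟨hi, h, h'⟩ | ⟨hi, h, h'⟩ <;>
    rw [h, h', hi] <;> simp only [Pi.add_apply, Pi.smul_apply, smul_eq_mul, Matrix.cons_val_zero,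
      Matrix.cons_val_one] <;> push_cast
  · have h0 : (0 : ℝ) ≤ k := k.cast_nonneg
    have h1 : 0 ≤ a * k + b * (k + 1) := by positivity
    rw [if_neg (by rintro ⟨h, -⟩; linarith), if_neg (by rintro ⟨h, -⟩; linarith)]
    have h2 : ⌊(a * k + b * (k + 1)) / (a * 1 + b * 1)⌋₊ = k := by
      rw [Nat.floor_eq_iff (by positivity)]
      constructor
      · rw [le_div_iff₀ (by positivity)]; linarith
      · rw [div_lt_iff₀ (by positivity)]; linarith
    rw [h2]
    omega
  · have h0 : (0 : ℝ) ≤ m := m.cast_nonneg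
    have h1 : 0 ≤ a * m + b * 1 := by positivity
    rw [if_neg (by rintro ⟨h, -⟩; linarith), if_neg (by rintro ⟨h, -⟩; linarith)]
    refine min_eq_right (Nat.le_floor ?_)
    rw [le_div_iff₀ (by linarith)]
    linarith
  · rw [if_neg (by rintro ⟨-, h⟩; linarith), if_pos ⟨by linarith, by linarith⟩]
  · rw [if_pos ⟨by linarith, by linarith⟩]

theorem exists_mem_closedCone_fanVec (x : Fin 2 → ℝ) :
    ∃ i : Fin (m + 3), x ∈ closedCone (fanVec m i) (fanVec m (i + 1)) := by
  have key : ∀ i : Fin (m + 3),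
      0 ≤ x 0 * (fanGen m (i + 1) 1 : ℝ) - x 1 * (fanGen m (i + 1) 0 : ℝ) →
      0 ≤ (fanGen m i 0 : ℝ) * x 1 - (fanGen m i 1 : ℝ) * x 0 →
      ∃ i : Fin (m + 3), x ∈ closedCone (fanVec m i) (fanVec m (i + 1)) := fun i h1 h2 =>
    ⟨i, (mem_closedCone_iff (by rw [planeDet_fanVec]; exact one_pos)).2 ⟨h1, h2⟩⟩
  by_cases hE : x 1 < 0 ∧ x 1 ≤ x 0
  · rcases fanGen_cases (⟨m + 2, by omega⟩ : Fin (m + 3)) with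
      ⟨k, hk, hi, -, -⟩ | ⟨hi, -, -⟩ | ⟨hi, -, -⟩ | ⟨-, h, h'⟩
    iterate 3 exact absurd hi (by simp; try omega)
    refine key ⟨m + 2, by omega⟩ ?_ ?_ <;>
        simp only [h, h', Matrix.cons_val_zero, Matrix.cons_val_one] <;>
      push_cast <;> linarith [hE.1, hE.2]
  by_cases hD : x 0 ≤ 0 ∧ x 0 < x 1
  · rcases fanGen_cases (⟨m + 1, by omega⟩ : Fin (m + 3)) with
      ⟨k, hk, hi, -, -⟩ | ⟨hi, -, -⟩ | ⟨-, h, h'⟩ | ⟨hi, -, -⟩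
    iterate 2 exact absurd hi (by simp; try omega)
    · refine key ⟨m + 1, by omega⟩ ?_ ?_ <;>
        simp only [h, h', Matrix.cons_val_zero, Matrix.cons_val_one] <;>
        push_cast <;> linarith [hD.1, hD.2]
    · exact absurd hi (by simp)
  have hx1 : 0 ≤ x 1 := by
    by_contra h
    rw [not_le] at h
    have : ¬ x 1 ≤ x 0 := fun h' => hE ⟨h, h'⟩
    exact hD ⟨by linarith, by linarith⟩
  have hx0 : 0 ≤ x 0 := by
    by_contra h
    exact hD ⟨by linarith, by linarith⟩
  by_cases hC : m * x 0 ≤ x 1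
  · rcases fanGen_cases (⟨m, by omega⟩ : Fin (m + 3)) with
      ⟨k, hk, hi, -, -⟩ | ⟨-, h, h'⟩ | ⟨hi, -, -⟩ | ⟨hi, -, -⟩
    · exact absurd hi (by simp; omega)
    · refine key ⟨m, by omega⟩ ?_ ?_ <;>
        simp only [h, h', Matrix.cons_val_zero, Matrix.cons_val_one] <;>
        push_cast <;> linarith
    iterate 2 exact absurd hi (by simp)
  rw [not_le] at hC
  have hx0' : 0 < x 0 := by
    rcases hx0.eq_or_lt with h | h
    · rw [← h] at hC; linarith
    · exact h
  have hfl := Nat.floor_le (div_nonneg hx1 hx0)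
  have hfl' := Nat.lt_floor_add_one (x 1 / x 0)
  rw [le_div_iff₀ hx0'] at hfl
  rw [div_lt_iff₀ hx0'] at hfl'
  set j := ⌊x 1 / x 0⌋₊
  have hj : j < m := by
    have : (j : ℝ) < m := lt_of_mul_lt_mul_right (hfl.trans_lt hC) hx0
    exact_mod_cast this
  rcases fanGen_cases (⟨j, by omega⟩ : Fin (m + 3)) with
    ⟨k, hk, hi, h, h'⟩ | ⟨hi, -, -⟩ | ⟨hi, -, -⟩ | ⟨hi, -, -⟩
  · have hkj : k = j := hi.symm
    subst hkj
    refine key ⟨j, by omega⟩ ?_ ?_ <;>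
        simp only [h, h', Matrix.cons_val_zero, Matrix.cons_val_one] <;>
      push_cast <;> linarith
  iterate 3 exact absurd hi (by simp; omega)

variable (m) in
/-- The complete fan with generators `fanGen m`. -/
def cyclicFan : CompleteFan where
  d := m + 2
  gen := fanGen m
  primitive i := by
    rcases fanGen_cases i with ⟨k, -, -, h, -⟩ | ⟨-, h, -⟩ | ⟨-, h, -⟩ | ⟨-, h, -⟩ <;> rw [h]
    · exact isCoprime_one_left
    · exact isCoprime_one_left
    · exact isCoprime_one_right
    · exact isCoprime_one_left.neg_left
  counterclockwise i := by
    rw [fanGen_unimodular]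
    exact one_pos
  disjoint i j hij := by
    rw [Set.disjoint_left]
    rintro x ⟨a, b, ha, hb, rfl⟩ ⟨a', b', ha', hb', h⟩
    refine hij (Fin.ext ?_)
    have h1 := sectorIndex_eq i ha hb.le
    have h2 := sectorIndex_eq j ha' hb'.le
    unfold fanVec at h1 h2
    rw [← h1, ← h2, h]
  complete := by
    rw [Set.eq_univ_iff_forall]
    intro x
    exact Set.mem_iUnion.2 (exists_mem_closedCone_fanVec x)

/-- The linear map that carries the generators of sector `i` to those of sector `i + p`. -/
def sectorMatrix (p i : Fin (m + 3)) : Matrix (Fin 2) (Fin 2) ℝ :=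
  Matrix.of fun r c =>
    ![fanVec m (i + 1) 1 * fanVec m (i + p) r - fanVec m i 1 * fanVec m (i + p + 1) r,
      fanVec m i 0 * fanVec m (i + p + 1) r - fanVec m (i + 1) 0 * fanVec m (i + p) r] c

theorem sectorMatrix_mulVec (p i : Fin (m + 3)) (x : Fin 2 → ℝ) :
    sectorMatrix p i *ᵥ x = planeDet x (fanVec m (i + 1)) • fanVec m (i + p) +
      planeDet (fanVec m i) x • fanVec m (i + p + 1) := by
  ext r
  simp only [sectorMatrix, Matrix.mulVec, dotProduct, Fin.sum_univ_two, Matrix.of_apply,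
    Matrix.cons_val_zero, Matrix.cons_val_one, Pi.add_apply, Pi.smul_apply, smul_eq_mul, planeDet]
  ring

theorem sectorMatrix_mulVec_add (p i : Fin (m + 3)) (a b : ℝ) :
    sectorMatrix p i *ᵥ (a • fanVec m i + b • fanVec m (i + 1)) =
      a • fanVec m (i + p) + b • fanVec m (i + p + 1) := by
  have h := planeDet_fanVec i
  have e1 : planeDet (a • fanVec m i + b • fanVec m (i + 1)) (fanVec m (i + 1)) = a := by
    calc _ = a * planeDet (fanVec m i) (fanVec m (i + 1)) := by
          simp only [planeDet, Pi.add_apply, Pi.smul_apply, smul_eq_mul]; ring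
      _ = a := by rw [h, mul_one]
  have e2 : planeDet (fanVec m i) (a • fanVec m i + b • fanVec m (i + 1)) = b := by
    calc _ = b * planeDet (fanVec m i) (fanVec m (i + 1)) := by
          simp only [planeDet, Pi.add_apply, Pi.smul_apply, smul_eq_mul]; ring
      _ = b := by rw [h, mul_one]
  rw [sectorMatrix_mulVec, e1, e2]

theorem det_sectorMatrix (p i : Fin (m + 3)) : (sectorMatrix p i).det = 1 := by
  have h := planeDet_mulVec (sectorMatrix p i) (fanVec m i) (fanVec m (i + 1))
  have h1 := sectorMatrix_mulVec_add p i 1 0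
  have h2 := sectorMatrix_mulVec_add p i 0 1
  simp only [one_smul, zero_smul, add_zero, zero_add] at h1 h2
  rw [h1, h2, planeDet_fanVec, planeDet_fanVec, mul_one] at h
  exact h.symm

theorem sectorIndex_lt (x : Fin 2 → ℝ) : sectorIndex m x < m + 3 := by
  unfold sectorIndex
  split_ifs <;> omega

/-- The piecewise linear map that carries sector `i` of the fan linearly to sector `i + p`. -/
noncomputable def fanRotation (p : Fin (m + 3)) (x : Fin 2 → ℝ) : Fin 2 → ℝ :=
  sectorMatrix p ⟨sectorIndex m x, sectorIndex_lt x⟩ *ᵥ x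

theorem fanRotation_add (p i : Fin (m + 3)) {a b : ℝ} (ha : 0 ≤ a) (hb : 0 ≤ b) :
    fanRotation p (a • fanVec m i + b • fanVec m (i + 1)) =
      a • fanVec m (i + p) + b • fanVec m (i + p + 1) := by
  have key : ∀ (i : Fin (m + 3)) {a b : ℝ}, 0 < a → 0 ≤ b →
      fanRotation p (a • fanVec m i + b • fanVec m (i + 1)) =
        a • fanVec m (i + p) + b • fanVec m (i + p + 1) := by
    intro i a b ha hb
    have : (⟨sectorIndex m (a • fanVec m i + b • fanVec m (i + 1)), sectorIndex_lt _⟩ :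
        Fin (m + 3)) = i := Fin.ext (sectorIndex_eq i ha hb)
    rw [fanRotation, this, sectorMatrix_mulVec_add]
  rcases ha.eq_or_lt with rfl | ha
  · rcases hb.eq_or_lt with rfl | hb
    · simp [fanRotation]
    · -- a multiple of the second generator belongs to the next half-open sector
      have h := key (i + 1) hb le_rfl
      simp only [zero_smul, add_zero, zero_add] at h ⊢
      rw [h, add_right_comm]
  · exact key i ha hb

theorem fanRotation_of_mem (p i : Fin (m + 3)) {x : Fin 2 → ℝ}
    (hx : x ∈ closedCone (fanVec m i) (fanVec m (i + 1))) :
    fanRotation p x = sectorMatrix p i *ᵥ x := by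
  obtain ⟨a, b, ha, hb, rfl⟩ := hx
  rw [fanRotation_add p i ha hb, sectorMatrix_mulVec_add]

theorem fanRotation_fanRotation (p q : Fin (m + 3)) (x : Fin 2 → ℝ) :
    fanRotation p (fanRotation q x) = fanRotation (q + p) x := by
  obtain ⟨i, a, b, ha, hb, rfl⟩ := exists_mem_closedCone_fanVec (m := m) x
  rw [fanRotation_add q i ha hb, fanRotation_add p _ ha hb, fanRotation_add _ i ha hb, add_assoc]

theorem fanRotation_zero (x : Fin 2 → ℝ) : fanRotation (0 : Fin (m + 3)) x = x := by
  obtain ⟨i, a, b, ha, hb, rfl⟩ := exists_mem_closedCone_fanVec (m := m) x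
  rw [fanRotation_add 0 i ha hb, add_zero]

theorem continuous_fanRotation (p : Fin (m + 3)) : Continuous (fanRotation p) := by
  refine (locallyFinite_of_finite fun i : Fin (m + 3) =>
    closedCone (fanVec m i) (fanVec m (i + 1))).continuous
    (Set.eq_univ_iff_forall.2 fun x => Set.mem_iUnion.2 (exists_mem_closedCone_fanVec x))
    (fun i => isClosed_closedCone (by rw [planeDet_fanVec]; exact one_pos)) fun i => ?_
  have : ContinuousOn (fun x => sectorMatrix p i *ᵥ x)
      (closedCone (fanVec m i) (fanVec m (i + 1))) := by fun_prop
  exact this.congr fun x hx => fanRotation_of_mem p i hx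

/-- The rotation of the fan by `p` sectors, as a homeomorphism of the plane. -/
noncomputable def fanHomeomorph (p : Fin (m + 3)) : (Fin 2 → ℝ) ≃ₜ (Fin 2 → ℝ) where
  toFun := fanRotation p
  invFun := fanRotation (-p)
  left_inv x := by rw [fanRotation_fanRotation, add_neg_cancel, fanRotation_zero]
  right_inv x := by rw [fanRotation_fanRotation, neg_add_cancel, fanRotation_zero]
  continuous_toFun := continuous_fanRotation p
  continuous_invFun := continuous_fanRotation (-p)

@[simp] theorem fanHomeomorph_apply (p : Fin (m + 3)) (x : Fin 2 → ℝ) :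
    fanHomeomorph p x = fanRotation p x := rfl

theorem fanHomeomorph_pow (n : ℕ) :
    (fanHomeomorph (1 : Fin (m + 3))) ^ n = fanHomeomorph (n • (1 : Fin (m + 3))) := by
  induction n with
  | zero =>
    ext1 x
    rw [zero_smul]
    exact (fanRotation_zero x).symm
  | succ n ih =>
    ext1 x
    rw [pow_succ', ih, succ_nsmul]
    exact fanRotation_fanRotation 1 (n • 1) x

theorem fanRotation_mem_integerLattice (p : Fin (m + 3)) {x : Fin 2 → ℝ}
    (hx : x ∈ integerLattice) : fanRotation p x ∈ integerLattice := by
  obtain ⟨i, hi⟩ := exists_mem_closedCone_fanVec (m := m) x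
  rw [fanRotation_of_mem p i hi, sectorMatrix_mulVec]
  obtain ⟨v, rfl⟩ := hx
  refine ⟨(v 0 * fanGen m (i + 1) 1 - v 1 * fanGen m (i + 1) 0) • fanGen m (i + p) +
    (fanGen m i 0 * v 1 - fanGen m i 1 * v 0) • fanGen m (i + p + 1), ?_⟩
  ext r
  simp [latticePoint, fanVec, planeDet]

theorem fanHomeomorph_mem_plAutomorphisms (p : Fin (m + 3)) :
    fanHomeomorph p ∈ plAutomorphisms := by
  have h : ∀ i : Fin (m + 3), 0 < (sectorMatrix p i).det ∧
      ∀ x ∈ closedCone (fanVec m i) (fanVec m (i + 1)), fanHomeomorph p x = sectorMatrix p i *ᵥ x :=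
    fun i => ⟨by rw [det_sectorMatrix]; exact one_pos, fun x hx => fanRotation_of_mem p i hx⟩
  refine ⟨⟨cyclicFan m, sectorMatrix p, h⟩, ?_⟩
  · ext x
    constructor
    · rintro ⟨y, hy, rfl⟩
      exact fanRotation_mem_integerLattice p hy
    · intro hx
      exact ⟨_, fanRotation_mem_integerLattice (-p) hx, (fanHomeomorph p).right_inv x⟩

/-- A nontrivial rotation of the fan fixes no ray. -/
theorem eq_zero_of_fanRotation_eq_smul {p : Fin (m + 3)} {x : Fin 2 → ℝ} (hx : x ≠ 0) {r : ℝ}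
    (hr : 0 < r) (h : fanRotation p x = r • x) : p = 0 := by
  obtain ⟨i, a, b, ha, hb, rfl⟩ : ∃ (i : Fin (m + 3)) (a b : ℝ), 0 < a ∧ 0 ≤ b ∧
      x = a • fanVec m i + b • fanVec m (i + 1) := by
    obtain ⟨i, a, b, ha, hb, rfl⟩ := exists_mem_closedCone_fanVec (m := m) x
    rcases ha.eq_or_lt with rfl | ha
    · rcases hb.eq_or_lt with rfl | hb
      · simp at hx
      · exact ⟨i + 1, b, 0, hb, le_rfl, by simp⟩
    · exact ⟨i, a, b, ha, hb, rfl⟩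
  rw [fanRotation_add p i ha.le hb, smul_add, smul_smul, smul_smul] at h
  have h1 := sectorIndex_eq (i + p) ha hb
  rw [h, sectorIndex_eq i (mul_pos hr ha) (by positivity)] at h1
  simpa using Fin.ext h1

theorem nsmul_one_ne_zero {n : ℕ} (h0 : 0 < n) (hn : n < m + 3) : n • (1 : Fin (m + 3)) ≠ 0 := by
  have : ∀ k : ℕ, k < m + 3 → ((k • (1 : Fin (m + 3)) : Fin (m + 3)) : ℕ) = k := by
    intro k
    induction k with
    | zero => intro _; rw [zero_smul]; rfl
    | succ k ih =>
      intro hk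
      rw [succ_nsmul, Fin.val_add_one_of_lt', ih (by omega)]
      rw [ih (by omega)]
      exact hk
  intro h
  have h' := this n hn
  rw [h] at h'
  simp at h'
  omega

/-- The rotation number of the rotation of the fan by one sector has denominator `m + 3`: a smaller
denominator would give a ray fixed by a nontrivial rotation of the fan. -/
theorem exists_translationNumber_fanHomeomorph {G : CircleDeg1Liftˣ}
    (hG : IsRayLift (fanHomeomorph (1 : Fin (m + 3))) G) :
    ∃ k : ℤ, IsCoprime k ((m + 3 : ℕ) : ℤ) ∧
      CircleDeg1Lift.translationNumber (G : CircleDeg1Lift) = k / (m + 3 : ℕ) := by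
  have hN : (m + 3) • (1 : Fin (m + 3)) = 0 := by
    simpa using card_nsmul_eq_zero (G := Fin (m + 3)) (x := 1)
  have h0 := (hG.pow (m + 3)).map_unitVec 0
  rw [fanHomeomorph_pow, hN, fanHomeomorph_apply, fanRotation_zero, norm_toComplex_unitVec,
    one_smul] at h0
  obtain ⟨k, hk⟩ := UnitAddCircle.coe_eq_coe_iff.1 (unitVec_eq_iff.1 h0)
  have ht : CircleDeg1Lift.translationNumber (G : CircleDeg1Lift) = k / (m + 3 : ℕ) :=
    CircleDeg1Lift.translationNumber_of_map_pow_eq_add_int _ (x := 0) (by simpa using hk)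
      (by omega)
  refine ⟨k, ?_, ht⟩
  rw [Int.isCoprime_iff_gcd_eq_one]
  by_contra hd
  set d := Int.gcd k ((m + 3 : ℕ) : ℤ) with hd'
  have hd0 : 0 < d := Int.gcd_pos_of_ne_zero_right _ (by omega)
  obtain ⟨k', hk'⟩ : (d : ℤ) ∣ k := Int.gcd_dvd_left _ _
  obtain ⟨n, hn⟩ : d ∣ m + 3 := by
    have : (d : ℤ) ∣ ((m + 3 : ℕ) : ℤ) := Int.gcd_dvd_right _ _
    exact_mod_cast this
  have hn0 : 0 < n := by
    rcases Nat.eq_zero_or_pos n with rfl | h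
    · omega
    · exact h
  have hnlt : n < m + 3 := by
    have : 2 ≤ d := by omega
    nlinarith
  have ht' : CircleDeg1Lift.translationNumber ((G ^ n : CircleDeg1Liftˣ) : CircleDeg1Lift) =
      k' := by
    rw [Units.val_pow_eq_pow_val, CircleDeg1Lift.translationNumber_pow, ht, hn, hk']
    have : (d : ℝ) ≠ 0 := by positivity
    have : (n : ℝ) ≠ 0 := by positivity
    push_cast
    field_simp
  obtain ⟨x, hx⟩ := (CircleDeg1Lift.translationNumber_eq_int_iff _
    (CircleDeg1Lift.units_continuous (G ^ n))).1 ht'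
  have h1 := (hG.pow n).map_unitVec x
  rw [hx, unitVec_eq_iff.2 (UnitAddCircle.coe_add_int x k'), fanHomeomorph_pow] at h1
  exact nsmul_one_ne_zero hn0 hnlt (eq_zero_of_fanRotation_eq_smul (unitVec_ne_zero x)
    (norm_toComplex_pos ((fanHomeomorph_pow (m := m) n ▸ (hG.pow n).homogeneous).ne_zero
      (unitVec_ne_zero x))) h1)

end CyclicFan

theorem exists_mem_plAutomorphisms_hasRayRotationNumber (r : ℚ) :
    ∃ F ∈ plAutomorphisms, HasRayRotationNumber F (((r : ℝ)) : UnitAddCircle) := by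
  have hden := r.den_pos
  obtain ⟨f, G, hfG, hG⟩ :=
    exists_isRayLift (fanHomeomorph_mem_plAutomorphisms (1 : Fin (3 * r.den - 3 + 3)))
  obtain ⟨k, hk, ht⟩ := exists_translationNumber_fanHomeomorph hG
  obtain ⟨n, hn⟩ := exists_pow_hasRotationNumber hfG (by omega) hk ht (3 * r.num)
  refine ⟨_ ^ n, ?_, f ^ n, (hG.pow n).inducesOnRays ?_, ?_⟩
  · rw [fanHomeomorph_pow]
    exact fanHomeomorph_mem_plAutomorphisms _
  · exact hfG.pow n
  convert hn using 2
  rw [show 3 * r.den - 3 + 3 = 3 * r.den by omega]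
  have : (r.den : ℝ) ≠ 0 := by positivity
  push_cast
  rw [mul_div_mul_left _ _ three_ne_zero]
  exact_mod_cast (Rat.num_div_den r).symm

theorem theoremA :
    ((∀ f ∈ thompsonT, ∃ r : ℚ, HasRotationNumber f (((r : ℝ)) : UnitAddCircle)) ∧
      (∀ r : ℚ, ∃ f ∈ thompsonT, HasRotationNumber f (((r : ℝ)) : UnitAddCircle))) ∧
    ((∀ F ∈ plAutomorphisms, ∃ r : ℚ, HasRayRotationNumber F (((r : ℝ)) : UnitAddCircle)) ∧
      (∀ r : ℚ, ∃ F ∈ plAutomorphisms, HasRayRotationNumber F (((r : ℝ)) : UnitAddCircle))) :=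
  ⟨⟨fun _ hf => exists_rat_of_mem_thompsonT hf, exists_mem_thompsonT_hasRotationNumber⟩,
    fun _ hF => exists_rat_of_mem_plAutomorphisms hF,
    exists_mem_plAutomorphisms_hasRayRotationNumber⟩
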